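/- Let $X$ be a shelf, i.e. a set with an operation $(x,y)\mapsto x^y$ satisfying $(x^y)^z=(x^z)^{(y^z)}$, and let $k$ be a commutative unital ring (e.g. $k=\mathbb Z$). Let $M=M(X)=\langle X : yx^y=xy\rangle$ be the structure monoid of $X$, and let $$B=k\langle x,e_y : x,y\in X\rangle/\langle yx^y-xy,\ ye_{x^y}-e_xy : x,y\in X\rangle,\qquad |x|=0,\ |e_x|=1,$$ with the differential $d$ (the superderivation with $d(e_x)=1-x$, $d(x)=0$) and the coproduct $\Delta$ (the algebra morphism $B\to B\otimes B$ with $\Delta(x)=x\otimes x$, $\Delta(e_x)=e_x\otimes x+1\otimes e_x$); all tensor products are over $k$, $B\otimes B$ carries the product $(a_1\otimes b_1)(a_2\otimes b_2)=(-1)^{|b_1||a_2|}a_1a_2\otimes b_1b_2$, the map $\mathrm{Id}\otimes d$ carries the Koszul sign, $(\mathrm{Id}\otimes d)(a\otimes b)=(-1)^{|a|}a\otimes d b$, and $\tau(a\otimes b)=(-1)^{|a||b|}b\otimes a$. The monomials $ae_{x_1}\cdots e_{x_n}$ with $a\in M$ form a basis of $B$. Let $\overline B=B/\langle xb-b : x\in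 X, b\in B\rangle$ with the induced $d,\Delta,\tau$; the monomials $e_{x_1}\cdots e_{x_n}$ form a basis of it. Let $h\colon B\to B\otimes B$ be the linear map $$h(ae_{x_1}\cdots e_{x_n})=\sum_{i=1}^n(-1)^{i-1}(a\otimes a)\,(\tau\Delta)(e_{x_1}\cdots e_{x_{i-1}})\,(e_{x_i}\otimes e_{x_i})\,\Delta(e_{x_{i+1}}\cdots e_{x_n})\qquad(a\in M;\ h(a)=0).$$ Let $C^n(X)=k^{X^n}$ and $C^n(X,M)=k^{M\times X^n}$ be the rack cochains, with differential $\delta f=f\circ\partial$, where $$\partial(m\,x_1\cdots x_n)=\sum_{i=1}^n(-1)^{i-1}\bigl(m\,x_1\cdots\widehat{x_i}\cdots x_n-m x_i\,x_1^{x_i}\cdots x_{i-1}^{x_i}x_{i+1}\cdots x_n\bigr)$$ for $C^\bullet(X,M)$, and the same formula without $m$ for $C^\bullet(X)$. Identify a cochain $f$ of degree $n$ with the functional on $\overline B$ (resp. $B$) with $f(e_{x_1}\cdots e_{x_n})=f(x_1,\dots,x_n)$ (resp. $f(me_{x_1}\cdots e_{x_n})=f(m,x_1,\dots,x_n)$)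 that vanishes in degrees other than $n$. The cup product is $f\smile g=\mu(f\otimes g)\Delta$, with $\mu$ the product of $k$ and $(f\otimes g)(a\otimes b)=(-1)^{|g||a|}f(a)\otimes g(b)$. **Theorem.** 1. $h$ has degree $1$, and $h(b_1b_2)=h(b_1)\Delta(b_2)+(-1)^{|b_1|}(\tau\Delta)(b_1)h(b_2)$ for all homogeneous $b_1,b_2\in B$. 2. $(d\otimes\mathrm{Id}+\mathrm{Id}\otimes d)h+hd=\Delta-\tau\Delta$ on $B$. 3. $h$ induces a map $\overline B\to\overline B\otimes\overline B$, still denoted $h$, and the identity of part 2 holds on $\overline B$. 4. On $C^\bullet(X)$ and on $C^\bullet(X,M)$, the cup product is a morphism of complexes and $H(f\otimes g)=\mu(f\otimes g)h$ is a homotopy between $\smile$ and $\smile^{op}=\smile\tau$: for cochains $f,g$ of degrees $p,q$, $$\delta(f\smile g)=(-1)^q\,\delta f\smile g+f\smile\delta g,$$ $$f\smile g-(-1)^{pq}g\smile f=\delta H(f\otimes g)+(-1)^qH(\delta f\otimes g)+H(f\otimes\delta g).$$ 5. Hence the cup product induces a product on the rack cohomology of $X$ with these coefficients, i.e. on the cohomology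 of $C^\bullet(X)$ and of $C^\bullet(X,M)$, and this product is graded commutative: $\alpha\smile\beta=(-1)^{pq}\beta\smile\alpha$ for classes $\alpha,\beta$ of degrees $p,q$. -/

import Mathlib

universe u v

namespace RackHomotopy

open scoped TensorProduct DirectSum

/-! ### The structure monoid and the algebra `B(X)` of a shelf

Mathlib's `Shelf` is written as a left action; the right operation `x ◁ y = x ^ y` used here is
`Shelf.act y x`, and `Shelf.self_distrib` is then `(x ◁ y) ◁ z = (x ◁ z) ◁ (y ◁ z)`. -/

/-- The right shelf operation `x ◁ y = x ^ y`. -/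
def rop {X : Type v} [Shelf X] (x y : X) : X := Shelf.act y x

theorem rop_rop {X : Type v} [Shelf X] (x y z : X) :
    rop (rop x y) z = rop (rop x z) (rop y z) := by
  simp only [rop]
  exact Shelf.self_distrib

/-- The relations `y x^y = x y` of the structure monoid. -/
inductive StructureRel (X : Type v) [Shelf X] : FreeMonoid X → FreeMonoid X → Prop
  | mk (x y : X) : StructureRel X
      (FreeMonoid.of y * FreeMonoid.of (rop x y)) (FreeMonoid.of x * FreeMonoid.of y)

/-- The structure monoid `M(X) = ⟨X : y x^y = x y⟩`. -/
abbrev StructureMonoid (X : Type v) [Shelf X] : Type v := PresentedMonoid (StructureRel X)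

/-- The generator of `M(X)` given by `x ∈ X`. -/
def mgen {X : Type v} [Shelf X] (x : X) : StructureMonoid X :=
  PresentedMonoid.of (StructureRel X) x

theorem mgen_rel {X : Type v} [Shelf X] (x y : X) :
    mgen y * mgen (rop x y) = mgen x * mgen y :=
  PresentedMonoid.mk_eq_mk_of_rel (StructureRel.mk x y)

/-- The relations of `B(X)`.  The letter `Sum.inl x` stands for the generator `x` and the letter
`Sum.inr x` for the generator `e_x`. -/
inductive BRel (k : Type u) [CommRing k] (X : Type v) [Shelf X] :
    FreeAlgebra k (X ⊕ X) → FreeAlgebra k (X ⊕ X) → Prop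
  | group (x y : X) : BRel k X
      (FreeAlgebra.ι k (Sum.inl y) * FreeAlgebra.ι k (Sum.inl (rop x y)))
      (FreeAlgebra.ι k (Sum.inl x) * FreeAlgebra.ι k (Sum.inl y))
  | mixed (x y : X) : BRel k X
      (FreeAlgebra.ι k (Sum.inl y) * FreeAlgebra.ι k (Sum.inr (rop x y)))
      (FreeAlgebra.ι k (Sum.inr x) * FreeAlgebra.ι k (Sum.inl y))

/-- The algebra `B(X, k) = k⟨x, e_y⟩ / ⟨y x^y - x y, y e_{x^y} - e_x y⟩`. -/
def B (k : Type u) [CommRing k] (X : Type v) [Shelf X] : Type (max u v) := RingQuot (BRel k X)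

section Algebra

variable (k : Type u) [CommRing k] (X : Type v) [Shelf X]

noncomputable instance : Ring (B k X) := inferInstanceAs (Ring (RingQuot (BRel k X)))

noncomputable instance : Algebra k (B k X) := inferInstanceAs (Algebra k (RingQuot (BRel k X)))

/-- The projection of the free algebra onto `B(X)`. -/
noncomputable def toB : FreeAlgebra k (X ⊕ X) →ₐ[k] B k X := RingQuot.mkAlgHom k (BRel k X)

theorem toB_surjective : Function.Surjective (toB k X) := RingQuot.mkAlgHom_surjective k (BRel k X)

variable {X}

/-- The generator of `B(X)` given by a letter. -/
noncomputable def letter (l : X ⊕ X) : B k X := toB k X (FreeAlgebra.ι k l)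

/-- The degree `0` generator `x` of `B(X)`. -/
noncomputable def gx (x : X) : B k X := letter k (Sum.inl x)

/-- The degree `1` generator `e_x` of `B(X)`. -/
noncomputable def ge (x : X) : B k X := letter k (Sum.inr x)

theorem gx_mul_gx (x y : X) : gx k y * gx k (rop x y) = gx k x * gx k y := by
  simp only [gx, letter, ← map_mul]
  exact RingQuot.mkAlgHom_rel k (BRel.group x y)

theorem gx_mul_ge (x y : X) : gx k y * ge k (rop x y) = ge k x * gx k y := by
  simp only [gx, ge, letter, ← map_mul]
  exact RingQuot.mkAlgHom_rel k (BRel.mixed x y)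

variable {k}

/-- The algebra morphism from `B(X)` with prescribed values on generators. -/
noncomputable def liftB {S : Type*} [Ring S] [Algebra k S] (f g : X → S)
    (h₁ : ∀ x y, f y * f (rop x y) = f x * f y) (h₂ : ∀ x y, f y * g (rop x y) = g x * f y) :
    B k X →ₐ[k] S :=
  RingQuot.liftAlgHom k ⟨FreeAlgebra.lift k (Sum.elim f g), by
    rintro _ _ (⟨x, y⟩ | ⟨x, y⟩)
    · simpa using h₁ x y
    · simpa using h₂ x y⟩

@[simp]
theorem liftB_gx {S : Type*} [Ring S] [Algebra k S] (f g : X → S)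
    (h₁ : ∀ x y, f y * f (rop x y) = f x * f y) (h₂ : ∀ x y, f y * g (rop x y) = g x * f y)
    (x : X) : liftB f g h₁ h₂ (gx k x) = f x := by
  have := RingQuot.liftAlgHom_mkAlgHom_apply (S := k) (s := BRel k X)
    (FreeAlgebra.lift k (Sum.elim f g)) (by
      rintro _ _ (⟨x, y⟩ | ⟨x, y⟩)
      · simpa using h₁ x y
      · simpa using h₂ x y) (FreeAlgebra.ι k (Sum.inl x))
  refine this.trans ?_
  simp

@[simp]
theorem liftB_ge {S : Type*} [Ring S] [Algebra k S] (f g : X → S)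
    (h₁ : ∀ x y, f y * f (rop x y) = f x * f y) (h₂ : ∀ x y, f y * g (rop x y) = g x * f y)
    (x : X) : liftB f g h₁ h₂ (ge k x) = g x := by
  have := RingQuot.liftAlgHom_mkAlgHom_apply (S := k) (s := BRel k X)
    (FreeAlgebra.lift k (Sum.elim f g)) (by
      rintro _ _ (⟨x, y⟩ | ⟨x, y⟩)
      · simpa using h₁ x y
      · simpa using h₂ x y) (FreeAlgebra.ι k (Sum.inr x))
  refine this.trans ?_
  simp

theorem B_induction {P : B k X → Prop} (h0 : ∀ r, P (algebraMap k _ r)) (hx : ∀ x, P (gx k x))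
    (he : ∀ x, P (ge k x)) (hm : ∀ a b, P a → P b → P (a * b)) (ha : ∀ a b, P a → P b → P (a + b))
    (b : B k X) : P b := by
  obtain ⟨b, rfl⟩ := toB_surjective k X b
  induction b using FreeAlgebra.induction with
  | grade0 r => simpa using h0 r
  | grade1 l =>
    rcases l with x | x
    · exact hx x
    · exact he x
  | mul a b iha ihb => simpa using hm _ _ iha ihb
  | add a b iha ihb => simpa using ha _ _ iha ihb

theorem algHom_ext_B {S : Type*} [Ring S] [Algebra k S] {f g : B k X →ₐ[k] S}
    (hx : ∀ x, f (gx k x) = g (gx k x)) (he : ∀ x, f (ge k x) = g (ge k x)) : f = g := by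
  ext b
  induction b using B_induction with
  | h0 r => simp
  | hx x => exact hx x
  | he x => exact he x
  | hm a b iha ihb => simp [iha, ihb]
  | ha a b iha ihb => simp [iha, ihb]

/-! ### The grading of `B(X)` -/

variable (k)

/-- The monomial of `B(X)` given by a word in the generators. -/
noncomputable def word (w : List (X ⊕ X)) : B k X := (w.map (letter k)).prod

variable (X)

/-- The degree `n` part of `B(X)`, for `|x| = 0` and `|e_x| = 1`: it is spanned by the monomials
containing exactly `n` letters of the form `e_x`. -/
noncomputable def gradeB (n : ℕ) : Submodule k (B k X) :=
  Submodule.span k {b | ∃ w : List (X ⊕ X), w.countP Sum.isRight = n ∧ word k w = b}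

variable {X}

theorem word_mem (w : List (X ⊕ X)) : word k w ∈ gradeB k X (w.countP Sum.isRight) :=
  Submodule.subset_span ⟨w, rfl, rfl⟩

theorem gx_mem (x : X) : gx k x ∈ gradeB k X 0 := by
  simpa [word, gx] using word_mem k [(Sum.inl x : X ⊕ X)]

theorem ge_mem (x : X) : ge k x ∈ gradeB k X 1 := by
  simpa [word, ge] using word_mem k [(Sum.inr x : X ⊕ X)]

instance : SetLike.GradedMonoid (gradeB k X) where
  one_mem := by simpa [word] using word_mem k ([] : List (X ⊕ X))
  mul_mem := by
    intro i j a b ha hb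
    have h : gradeB k X i * gradeB k X j ≤ gradeB k X (i + j) := by
      unfold gradeB
      rw [Submodule.span_mul_span, Submodule.span_le]
      rintro _ ⟨_, ⟨w, hw, rfl⟩, _, ⟨w', hw', rfl⟩, rfl⟩
      refine Submodule.subset_span ⟨w ++ w', by simp [hw, hw'], by simp [word]⟩
    exact h (Submodule.mul_mem_mul ha hb)

/-- Auxiliary: the decomposition of the elements of `B(X)` into homogeneous components. -/
noncomputable def decomposeB : B k X →ₐ[k] ⨁ n, gradeB k X n :=
  liftB (fun x => DirectSum.of (fun n => gradeB k X n) 0 ⟨gx k x, gx_mem k x⟩)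
    (fun x => DirectSum.of (fun n => gradeB k X n) 1 ⟨ge k x, ge_mem k x⟩)
    (fun x y => by
      simp only [DirectSum.of_mul_of]
      exact DirectSum.of_eq_of_gradedMonoid_eq (Sigma.subtype_ext rfl (gx_mul_gx k x y)))
    (fun x y => by
      simp only [DirectSum.of_mul_of]
      exact DirectSum.of_eq_of_gradedMonoid_eq (Sigma.subtype_ext rfl (gx_mul_ge k x y)))

theorem decomposeB_word (w : List (X ⊕ X)) :
    decomposeB k (word k w) =
      DirectSum.of (fun n => gradeB k X n) (w.countP Sum.isRight) ⟨word k w, word_mem k w⟩ := by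
  induction w with
  | nil => simp only [word, List.map_nil, List.prod_nil, map_one]; rfl
  | cons l w ih =>
    have hw : word k (l :: w) = letter k l * word k w := by simp [word]
    have hl : decomposeB k (letter k l) = DirectSum.of (fun n => gradeB k X n)
        ([l].countP Sum.isRight) ⟨letter k l, by simpa [word] using word_mem k [l]⟩ := by
      rcases l with x | x
      · exact liftB_gx ..
      · exact liftB_ge ..
    refine (congrArg (decomposeB k) hw).trans ?_
    rw [map_mul, ih, hl, DirectSum.of_mul_of]
    refine DirectSum.of_eq_of_gradedMonoid_eq (Sigma.subtype_ext ?_ ?_)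
    · exact (List.countP_append (p := Sum.isRight) (l₁ := [l]) (l₂ := w)).symm
    · exact hw.symm

noncomputable instance : GradedAlgebra (gradeB k X) :=
  GradedAlgebra.ofAlgHom _ (decomposeB k)
    (algHom_ext_B (fun x => by simp [decomposeB]) (fun x => by simp [decomposeB]))
    (fun i b => by
      obtain ⟨b, hb⟩ := b
      induction hb using Submodule.span_induction with
      | mem b h =>
        obtain ⟨w, rfl, rfl⟩ := h
        exact decomposeB_word k w
      | zero => exact (map_zero _).trans (map_zero (DirectSum.of (fun n => gradeB k X n) i)).symm
      | add a b ha hb iha ihb =>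
        have := congrArg₂ (· + ·) iha ihb
        simp only [← map_add] at this
        exact this
      | smul r a ha iha =>
        simp only [map_smul] at iha ⊢
        rw [iha]
        exact (DirectSum.lof k ℕ (fun n => gradeB k X n) i).map_smul r ⟨a, ha⟩ |>.symm)

end Algebra

/-! ### Graded modules: parity, signed flip, differential of a tensor square -/

section GradedModule

variable {k : Type u} [CommRing k] {V : Type v} [AddCommGroup V] [Module k V]

/-- The parity map `v ↦ (-1)^{|v|} v` of a graded module. -/
noncomputable def parity (𝒱 : ℕ → Submodule k V) [DirectSum.Decomposition 𝒱] : V →ₗ[k] V :=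
  (DirectSum.decomposeLinearEquiv 𝒱).symm.toLinearMap ∘ₗ
    DirectSum.lmap (fun n : ℕ => ((-1 : k) ^ n) • (LinearMap.id : 𝒱 n →ₗ[k] 𝒱 n)) ∘ₗ
    (DirectSum.decomposeLinearEquiv 𝒱).toLinearMap

theorem parity_of_mem (𝒱 : ℕ → Submodule k V) [DirectSum.Decomposition 𝒱] {n : ℕ} {v : V}
    (hv : v ∈ 𝒱 n) : parity 𝒱 v = (-1 : k) ^ n • v := by
  lift v to 𝒱 n using hv
  simp [parity, DirectSum.lmap_lof]

/-- The signed flip `τ(v ⊗ w) = (-1)^{|v||w|} w ⊗ v` of a graded module. -/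
noncomputable def signedFlip (𝒱 : ℕ → Submodule k V) [DirectSum.Decomposition 𝒱] :
    V ⊗[k] V →ₗ[k] V ⊗[k] V :=
  (TensorProduct.congr (DirectSum.decomposeLinearEquiv 𝒱).symm
      (DirectSum.decomposeLinearEquiv 𝒱).symm).toLinearMap ∘ₗ
    (TensorProduct.gradedComm k (fun n => 𝒱 n) (fun n => 𝒱 n)).toLinearMap ∘ₗ
    (TensorProduct.congr (DirectSum.decomposeLinearEquiv 𝒱)
      (DirectSum.decomposeLinearEquiv 𝒱)).toLinearMap

theorem signedFlip_tmul (𝒱 : ℕ → Submodule k V) [DirectSum.Decomposition 𝒱] {i j : ℕ} {v w : V}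
    (hv : v ∈ 𝒱 i) (hw : w ∈ 𝒱 j) :
    signedFlip 𝒱 (v ⊗ₜ w) = (-1 : k) ^ (i * j) • (w ⊗ₜ v) := by
  lift v to 𝒱 i using hv
  lift w to 𝒱 j using hw
  simp only [signedFlip, LinearMap.comp_apply, LinearEquiv.coe_coe, TensorProduct.congr_tmul,
    DirectSum.decomposeLinearEquiv_apply_coe]
  rw [TensorProduct.gradedComm_of_tmul_of, Units.smul_def, map_zsmul, TensorProduct.congr_tmul,
    DirectSum.decomposeLinearEquiv_symm_lof, DirectSum.decomposeLinearEquiv_symm_lof,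
    ← Int.cast_smul_eq_zsmul k, mul_comm j i]
  congr 1
  simp

/-- The map `d ⊗ Id + Id ⊗ d` with the Koszul sign:
`v ⊗ w ↦ d v ⊗ w + (-1)^{|v|} v ⊗ d w`. -/
noncomputable def tensorDiff (𝒱 : ℕ → Submodule k V) [DirectSum.Decomposition 𝒱] (d : V →ₗ[k] V) :
    V ⊗[k] V →ₗ[k] V ⊗[k] V :=
  TensorProduct.map d LinearMap.id + TensorProduct.map (parity 𝒱) d

/-- The degree `n` part of the tensor square of a graded module. -/
noncomputable def tensorGrade (𝒱 : ℕ → Submodule k V) (n : ℕ) : Submodule k (V ⊗[k] V) :=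
  Submodule.span k {t | ∃ i j : ℕ, i + j = n ∧ ∃ v ∈ 𝒱 i, ∃ w ∈ 𝒱 j, v ⊗ₜ[k] w = t}

end GradedModule

/-! ### The differential and the coproduct of `B(X)` -/

section Bialgebra

variable (k : Type u) [CommRing k] (X : Type v) [Shelf X]

/-- Auxiliary: the sign automorphism `x ↦ x`, `e_x ↦ -e_x` of `B(X)`. -/
noncomputable def signB : B k X →ₐ[k] B k X :=
  liftB (gx k) (fun x => -ge k x) (gx_mul_gx k) (fun x y => by simp [gx_mul_ge])

/-- Auxiliary: `b ↦ !![±b, d b; 0, b]`, which is an algebra morphism because `d` is a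
superderivation. -/
noncomputable def diffMatrix : B k X →ₐ[k] Matrix (Fin 2) (Fin 2) (B k X) :=
  liftB (fun x => !![gx k x, 0; 0, gx k x]) (fun x => !![-ge k x, 1 - gx k x; 0, ge k x])
    (fun x y => by simp [gx_mul_gx])
    (fun x y => by simp [gx_mul_ge, mul_sub, sub_mul, gx_mul_gx])

/-- The differential `d` of `B(X)`: the superderivation with `d(e_x) = 1 - x` and `d(x) = 0`, see
`diffB_gx`, `diffB_ge` and `diffB_mul`. -/
noncomputable def diffB : B k X →ₗ[k] B k X :=
  (Matrix.entryLinearMap k (B k X) 0 1) ∘ₗ (diffMatrix k X).toLinearMap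

variable {X}

theorem diffB_gx (x : X) : diffB k X (gx k x) = 0 := by simp [diffB, diffMatrix]

theorem diffB_ge (x : X) : diffB k X (ge k x) = 1 - gx k x := by simp [diffB, diffMatrix]

theorem diffMatrix_apply (b : B k X) :
    diffMatrix k X b = !![signB k X b, diffB k X b; 0, b] := by
  have key : ∀ b : B k X, diffMatrix k X b 0 0 = signB k X b ∧ diffMatrix k X b 1 0 = 0 ∧
      diffMatrix k X b 1 1 = b := by
    intro b
    induction b using B_induction with
    | h0 r => simp [Matrix.algebraMap_matrix_apply]
    | hx x => simp [diffMatrix, signB]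
    | he x => simp [diffMatrix, signB]
    | hm a b iha ihb => simp [Matrix.mul_apply, iha, ihb]
    | ha a b iha ihb => simp [iha, ihb]
  obtain ⟨h1, h2, h3⟩ := key b
  ext i j
  fin_cases i <;> fin_cases j
  · exact h1
  · rfl
  · exact h2
  · exact h3

theorem diffB_mul' (a b : B k X) :
    diffB k X (a * b) = diffB k X a * b + signB k X a * diffB k X b := by
  have h : diffB k X (a * b) = diffMatrix k X (a * b) 0 1 := rfl
  rw [h, map_mul, diffMatrix_apply, diffMatrix_apply]
  simp [Matrix.mul_apply, add_comm]

theorem signB_of_mem {n : ℕ} {b : B k X} (hb : b ∈ gradeB k X n) :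
    signB k X b = (-1 : k) ^ n • b := by
  induction hb using Submodule.span_induction with
  | mem b h =>
    obtain ⟨w, rfl, rfl⟩ := h
    induction w with
    | nil => simp [word]
    | cons l w ih =>
      have hw : word k (l :: w) = letter k l * word k w := by simp [word]
      rw [hw, map_mul, ih]
      rcases l with x | x
      · have : signB k X (letter k (Sum.inl x)) = letter k (Sum.inl x) := liftB_gx ..
        simp [this]
      · have : signB k X (letter k (Sum.inr x)) = -letter k (Sum.inr x) := liftB_ge ..
        simp [this, pow_succ, List.countP_cons]
  | zero => simp
  | add a b _ _ iha ihb => simp [iha, ihb]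
  | smul r a _ iha => rw [map_smul, iha, smul_comm]

/-- `d` is a superderivation. -/
theorem diffB_mul {n : ℕ} {a : B k X} (ha : a ∈ gradeB k X n) (b : B k X) :
    diffB k X (a * b) = diffB k X a * b + (-1 : k) ^ n • (a * diffB k X b) := by
  rw [diffB_mul', signB_of_mem k ha, smul_mul_assoc]

variable (X)

/-- The algebra `B(X) ⊗ B(X)`, whose product
`(a₁ ⊗ b₁)(a₂ ⊗ b₂) = (-1)^{|b₁||a₂|} a₁ a₂ ⊗ b₁ b₂` involves the Koszul sign. -/
abbrev BB : Type (max u v) := gradeB k X ᵍ⊗[k] gradeB k X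

variable {X}

/-- The pure tensor `a ⊗ b` in the algebra `B(X) ⊗ B(X)`. -/
noncomputable def tm (a b : B k X) : BB k X := GradedTensorProduct.tmul k a b

theorem tm_mul_tm {j i : ℕ} {a₁ b₁ a₂ b₂ : B k X} (hb : b₁ ∈ gradeB k X j)
    (ha : a₂ ∈ gradeB k X i) :
    tm k a₁ b₁ * tm k a₂ b₂ = (-1 : k) ^ (j * i) • tm k (a₁ * a₂) (b₁ * b₂) := by
  lift b₁ to gradeB k X j using hb
  lift a₂ to gradeB k X i using ha
  refine (GradedTensorProduct.tmul_coe_mul_coe_tmul _ _ _ _ _ _).trans ?_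
  rw [Units.smul_def, ← Int.cast_smul_eq_zsmul k]
  congr 1
  simp

variable (X)

/-- The coproduct of `B(X)`: the algebra morphism with `Δ(x) = x ⊗ x` and
`Δ(e_x) = e_x ⊗ x + 1 ⊗ e_x`. -/
noncomputable def coprod : B k X →ₐ[k] BB k X :=
  liftB (fun x => tm k (gx k x) (gx k x)) (fun x => tm k (ge k x) (gx k x) + tm k 1 (ge k x))
    (fun x y => by
      rw [tm_mul_tm k (gx_mem k _) (gx_mem k _), tm_mul_tm k (gx_mem k _) (gx_mem k _),
        gx_mul_gx])
    (fun x y => by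
      rw [mul_add, add_mul, tm_mul_tm k (gx_mem k _) (ge_mem k _),
        tm_mul_tm k (gx_mem k _) SetLike.GradedOne.one_mem,
        tm_mul_tm k (gx_mem k _) (gx_mem k _), tm_mul_tm k (ge_mem k _) (gx_mem k _),
        gx_mul_gx, gx_mul_ge]
      simp)

/-- The signed flip `τ(a ⊗ b) = (-1)^{|a||b|} b ⊗ a`, as an automorphism of the algebra
`B(X) ⊗ B(X)`. -/
noncomputable def flipB : BB k X ≃ₐ[k] BB k X := GradedTensorProduct.comm (gradeB k X) (gradeB k X)

/-- The identity map from the algebra `B(X) ⊗ B(X)` to the underlying tensor product of modules. -/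
noncomputable def untwist : BB k X ≃ₗ[k] B k X ⊗[k] B k X :=
  (GradedTensorProduct.of k (gradeB k X) (gradeB k X)).symm

theorem untwist_tm (a b : B k X) : untwist k X (tm k a b) = a ⊗ₜ b := rfl

/-- The two descriptions of the signed flip agree. -/
theorem untwist_flipB (t : BB k X) :
    untwist k X (flipB k X t) = signedFlip (gradeB k X) (untwist k X t) := rfl

/-- The coproduct of `B(X)` as a linear map. -/
noncomputable def coprodLin : B k X →ₗ[k] B k X ⊗[k] B k X :=
  (untwist k X).toLinearMap ∘ₗ (coprod k X).toLinearMap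

end Bialgebra

/-! ### Canonical monomials -/

section Canonical

variable (k : Type u) [CommRing k] (X : Type v) [Shelf X]

/-- The algebra map `A(X) → B(X)`, `x ↦ x`, on the monoid `M(X)` of monomials of `A(X)`. -/
noncomputable def monB : StructureMonoid X →* B k X :=
  PresentedMonoid.lift (gx k) (by
    rintro _ _ ⟨x, y⟩
    simpa using gx_mul_gx k x y)

variable {X}

theorem monB_mgen (x : X) : monB k X (mgen x) = gx k x := rfl

/-- The monomial `e_{x_1} ⋯ e_{x_n}`. -/
noncomputable def eWord (u : List X) : B k X := (u.map (ge k)).prod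

/-- The canonical monomial `a e_{x_1} ⋯ e_{x_n}`, for `a ∈ M(X)`. -/
noncomputable def canonical (p : StructureMonoid X × List X) : B k X :=
  monB k X p.1 * eWord k p.2

theorem eWord_mul_gx (u : List X) (y : X) :
    eWord k u * gx k y = gx k y * eWord k (u.map fun x => rop x y) := by
  induction u with
  | nil => simp [eWord]
  | cons x u ih =>
    simp only [eWord, List.map_cons, List.prod_cons] at ih ⊢
    rw [mul_assoc, ih, ← mul_assoc, ← gx_mul_ge, mul_assoc]

/-- Auxiliary: the right action of `x` on canonical monomials. -/
def actX (x : X) (p : StructureMonoid X × List X) : StructureMonoid X × List X :=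
  (p.1 * mgen x, p.2.map fun z => rop z x)

/-- Auxiliary: the right action of `e_x` on canonical monomials. -/
def actE (x : X) (p : StructureMonoid X × List X) : StructureMonoid X × List X :=
  (p.1, p.2 ++ [x])

variable (X)

/-- Auxiliary: the right action of `B(X)` on formal combinations of canonical monomials. -/
noncomputable def actB :
    B k X →ₐ[k] (Module.End k (StructureMonoid X × List X →₀ k))ᵐᵒᵖ :=
  liftB (fun x => MulOpposite.op (Finsupp.lmapDomain k k (actX x)))
    (fun x => MulOpposite.op (Finsupp.lmapDomain k k (actE x)))
    (fun x y => by
      rw [← MulOpposite.op_mul, ← MulOpposite.op_mul, Module.End.mul_eq_comp,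
        Module.End.mul_eq_comp, ← Finsupp.lmapDomain_comp, ← Finsupp.lmapDomain_comp]
      congr 2
      funext p
      simp [actX, mul_assoc, mgen_rel, ← rop_rop])
    (fun x y => by
      rw [← MulOpposite.op_mul, ← MulOpposite.op_mul, Module.End.mul_eq_comp,
        Module.End.mul_eq_comp, ← Finsupp.lmapDomain_comp, ← Finsupp.lmapDomain_comp]
      congr 2
      funext p
      simp [actX, actE])

/-- Auxiliary: the expansion of an element of `B(X)` in canonical monomials. -/
noncomputable def normalForm : B k X →ₗ[k] (StructureMonoid X × List X →₀ k) :=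
  LinearMap.applyₗ (Finsupp.single (1, []) 1) ∘ₗ
    (MulOpposite.opLinearEquiv k).symm.toLinearMap ∘ₗ (actB k X).toLinearMap

variable {X}

theorem normalForm_apply (b : B k X) :
    normalForm k X b = (actB k X b).unop (Finsupp.single (1, []) 1) := rfl

theorem normalForm_mul_gx (b : B k X) (x : X) :
    normalForm k X (b * gx k x) = Finsupp.mapDomain (actX x) (normalForm k X b) := by
  simp [normalForm_apply, actB]

theorem normalForm_mul_ge (b : B k X) (x : X) :
    normalForm k X (b * ge k x) = Finsupp.mapDomain (actE x) (normalForm k X b) := by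
  simp [normalForm_apply, actB]

theorem normalForm_canonical (p : StructureMonoid X × List X) :
    normalForm k X (canonical k p) = Finsupp.single p 1 := by
  obtain ⟨m, u⟩ := p
  have hm : normalForm k X (monB k X m) = Finsupp.single (m, []) 1 := by
    obtain ⟨w, rfl⟩ := PresentedMonoid.surjective_mk m
    rw [← FreeMonoid.ofList_toList w]
    generalize FreeMonoid.toList w = l
    induction l using List.reverseRecOn with
    | nil => simp [normalForm_apply]
    | append_singleton l x ih =>
      rw [FreeMonoid.ofList_append, map_mul, map_mul]
      have : monB k X (PresentedMonoid.mk (StructureRel X) (FreeMonoid.ofList [x])) = gx k x :=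
        rfl
      rw [this, normalForm_mul_gx, ih, Finsupp.mapDomain_single]
      rfl
  induction u using List.reverseRecOn with
  | nil => simpa [canonical, eWord] using hm
  | append_singleton u x ih =>
    have : canonical k (m, u ++ [x]) = canonical k (m, u) * ge k x := by
      simp [canonical, eWord, mul_assoc]
    rw [this, normalForm_mul_ge, ih, Finsupp.mapDomain_single]
    rfl

theorem linearCombination_actB (b : B k X) (n : StructureMonoid X × List X →₀ k) :
    Finsupp.linearCombination k (canonical k) ((actB k X b).unop n) =
      Finsupp.linearCombination k (canonical k) n * b := by
  induction b using B_induction generalizing n with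
  | h0 r => simp [Algebra.algebraMap_eq_smul_one]
  | hx x =>
    induction n using Finsupp.induction_linear with
    | zero => simp
    | add a b iha ihb => simp [iha, ihb, add_mul]
    | single p r =>
      have : canonical k (actX x p) = canonical k p * gx k x := by
        simp [canonical, actX, monB_mgen, mul_assoc, eWord_mul_gx]
      simp [actB, this]
  | he x =>
    induction n using Finsupp.induction_linear with
    | zero => simp
    | add a b iha ihb => simp [iha, ihb, add_mul]
    | single p r =>
      have : canonical k (actE x p) = canonical k p * ge k x := by
        simp [canonical, actE, eWord, mul_assoc]
      simp [actB, this]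
  | hm a b iha ihb => simp [iha, ihb, mul_assoc]
  | ha a b iha ihb => simp [iha, ihb, mul_add]

theorem linearCombination_normalForm (b : B k X) :
    Finsupp.linearCombination k (canonical k) (normalForm k X b) = b := by
  rw [normalForm_apply, linearCombination_actB]
  simp [canonical, eWord]

variable (X)

/-- The basis of `B(X)` given by the canonical monomials. -/
noncomputable def basisB : Module.Basis (StructureMonoid X × List X) k (B k X) :=
  Module.Basis.ofRepr
    { normalForm k X with
      invFun := Finsupp.linearCombination k (canonical k)
      left_inv := linearCombination_normalForm k
      right_inv := fun n => by
        change normalForm k X (Finsupp.linearCombination k (canonical k) n) = n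
        induction n using Finsupp.induction_linear with
        | zero => simp
        | add a b iha ihb => simp [iha, ihb]
        | single p r => simp [normalForm_canonical] }

variable {X}

theorem basisB_apply (p : StructureMonoid X × List X) : basisB k X p = canonical k p := by
  refine (basisB k X).repr.injective ?_
  rw [Module.Basis.repr_self]
  exact (normalForm_canonical k p).symm

end Canonical

/-! ### The homotopy `h` -/

section Homotopy

variable (k : Type u) [CommRing k] (X : Type v) [Shelf X]

/-- The linear map `h : B(X) → B(X) ⊗ B(X)`, defined on canonical monomials by
`h(a e_{x_1} ⋯ e_{x_n}) = ∑_i (-1)^{i-1} (a ⊗ a) (τΔ)(e_{x_1} ⋯ e_{x_{i-1}}) (e_{x_i} ⊗ e_{x_i})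
Δ(e_{x_{i+1}} ⋯ e_{x_n})`. -/
noncomputable def homotopyB : B k X →ₗ[k] BB k X :=
  (basisB k X).constr k fun p =>
    ∑ i : Fin p.2.length, (-1 : k) ^ (i : ℕ) •
      (tm k (monB k X p.1) (monB k X p.1) * flipB k X (coprod k X (eWord k (p.2.take i))) *
        tm k (ge k (p.2.get i)) (ge k (p.2.get i)) * coprod k X (eWord k (p.2.drop (i + 1))))

/-- The map `h` with values in the underlying tensor product of modules. -/
noncomputable def homotopyLin : B k X →ₗ[k] B k X ⊗[k] B k X :=
  (untwist k X).toLinearMap ∘ₗ homotopyB k X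

end Homotopy

/-! ### The quotient `B̄(X)` -/

section Quotient

variable (k : Type u) [CommRing k] (X : Type v) [Shelf X]

/-- The submodule of `B(X)` spanned by the elements `x b - b`. -/
noncomputable def relBar : Submodule k (B k X) :=
  Submodule.span k {t | ∃ (x : X) (b : B k X), gx k x * b - b = t}

/-- The module `B̄(X) = k ⊗_A B(X) = B(X) / ⟨x b - b⟩`. -/
def BBar : Type (max u v) := B k X ⧸ relBar k X

noncomputable instance : AddCommGroup (BBar k X) :=
  inferInstanceAs (AddCommGroup (B k X ⧸ relBar k X))

noncomputable instance : Module k (BBar k X) :=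
  inferInstanceAs (Module k (B k X ⧸ relBar k X))

/-- The projection `B(X) → B̄(X)`. -/
noncomputable def toBar : B k X →ₗ[k] BBar k X := (relBar k X).mkQ

theorem toBar_surjective : Function.Surjective (toBar k X) := (relBar k X).mkQ_surjective

variable {X}

theorem toBar_gx_mul (x : X) (b : B k X) : toBar k X (gx k x * b) = toBar k X b := by
  rw [← sub_eq_zero, ← map_sub]
  exact (Submodule.Quotient.mk_eq_zero _).2 (Submodule.subset_span ⟨x, b, rfl⟩)

/-- The map on `B̄(X)` induced by a linear map `f` on `B(X)` with `f(x b) = f(b)`. -/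
noncomputable def liftBar {W : Type*} [AddCommGroup W] [Module k W] (f : B k X →ₗ[k] W)
    (hf : ∀ x b, f (gx k x * b) = f b) : BBar k X →ₗ[k] W :=
  (relBar k X).liftQ f (by
    rw [relBar, Submodule.span_le]
    rintro _ ⟨x, b, rfl⟩
    simp [hf])

theorem liftBar_toBar {W : Type*} [AddCommGroup W] [Module k W] (f : B k X →ₗ[k] W)
    (hf : ∀ x b, f (gx k x * b) = f b) (b : B k X) : liftBar k f hf (toBar k X b) = f b := rfl

variable (X)

/-- The differential of `B̄(X)` induced by `d`. -/
noncomputable def diffBar : BBar k X →ₗ[k] BBar k X :=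
  liftBar k (toBar k X ∘ₗ diffB k X) (fun x b => by
    simp [diffB_mul k (gx_mem k x), diffB_gx, toBar_gx_mul])

theorem diffBar_toBar (b : B k X) : diffBar k X (toBar k X b) = toBar k X (diffB k X b) := rfl

/-- The coproduct of `B̄(X)` induced by `Δ`. -/
noncomputable def coprodBar : BBar k X →ₗ[k] BBar k X ⊗[k] BBar k X :=
  liftBar k (TensorProduct.map (toBar k X) (toBar k X) ∘ₗ coprodLin k X)
    (fun x b => by
      have key : ∀ t : BB k X, TensorProduct.map (toBar k X) (toBar k X)
          (untwist k X (tm k (gx k x) (gx k x) * t)) =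
          TensorProduct.map (toBar k X) (toBar k X) (untwist k X t) := by
        intro t
        obtain ⟨t, rfl⟩ := (untwist k X).symm.surjective t
        induction t using TensorProduct.induction_on with
        | zero => simp
        | add s t ihs iht => simp only [map_add, mul_add, ihs, iht]
        | tmul a b =>
          induction a using DirectSum.Decomposition.inductionOn (gradeB k X) with
          | zero => simp
          | add a a' iha iha' =>
            simp only [TensorProduct.add_tmul, map_add, mul_add, iha, iha']
          | homogeneous a =>
            change TensorProduct.map (toBar k X) (toBar k X)
              (untwist k X (tm k (gx k x) (gx k x) * tm k a b)) =
              TensorProduct.map (toBar k X) (toBar k X) (untwist k X (tm k a b))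
            rw [tm_mul_tm k (gx_mem k x) a.2]
            simp [untwist_tm, toBar_gx_mul]
      have hx : coprod k X (gx k x) = tm k (gx k x) (gx k x) := liftB_gx ..
      simp [coprodLin, hx, key])

theorem coprodBar_toBar (b : B k X) : coprodBar k X (toBar k X b) =
    TensorProduct.map (toBar k X) (toBar k X) (coprodLin k X b) := rfl

/-- The grading of `B̄(X)` induced by that of `B(X)`. -/
noncomputable def gradeBar (n : ℕ) : Submodule k (BBar k X) := (gradeB k X n).map (toBar k X)

/-- Auxiliary: the projection `B(X) → B̄(X)` on the degree `n` part. -/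
noncomputable def toBarGrade (n : ℕ) : gradeB k X n →ₗ[k] gradeBar k X n :=
  (toBar k X).restrict fun _ hb => Submodule.mem_map_of_mem hb

/-- Auxiliary: the projection `B(X) → B̄(X)` on all homogeneous components. -/
noncomputable def toBarTotal : (⨁ n, gradeB k X n) →ₗ[k] ⨁ n, gradeBar k X n :=
  DirectSum.lmap (toBarGrade k X)

theorem toBarTotal_lof (n : ℕ) (b : gradeB k X n) :
    toBarTotal k X (DirectSum.lof k ℕ (fun n => gradeB k X n) n b) =
      DirectSum.lof k ℕ (fun n => gradeBar k X n) n (toBarGrade k X n b) :=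
  DirectSum.lmap_lof ..

/-- Auxiliary: the decomposition of the elements of `B̄(X)` into homogeneous components. -/
noncomputable def decomposeBar : BBar k X →ₗ[k] ⨁ n, gradeBar k X n :=
  liftBar k (toBarTotal k X ∘ₗ
    (DirectSum.decomposeLinearEquiv (gradeB k X)).toLinearMap) (fun x b => by
      induction b using DirectSum.Decomposition.inductionOn (gradeB k X) with
      | zero => simp
      | add a b iha ihb => simp only [mul_add, map_add, iha, ihb]
      | @homogeneous n b =>
        have hb : gx k x * (b : B k X) ∈ gradeB k X n := by
          simpa using SetLike.mul_mem_graded (gx_mem k x) b.2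
        have h1 := DirectSum.decomposeLinearEquiv_apply_coe (R := k) (gradeB k X) n ⟨_, hb⟩
        simp only [LinearMap.comp_apply, LinearEquiv.coe_coe] at h1 ⊢
        rw [h1, DirectSum.decomposeLinearEquiv_apply_coe, toBarTotal_lof, toBarTotal_lof]
        congr 1
        exact Subtype.ext (toBar_gx_mul k x b))

noncomputable instance : DirectSum.Decomposition (gradeBar k X) :=
  DirectSum.Decomposition.ofLinearMap _ (decomposeBar k X)
    (by
      refine LinearMap.ext fun t => ?_
      obtain ⟨b, rfl⟩ := toBar_surjective k X t
      induction b using DirectSum.Decomposition.inductionOn (gradeB k X) with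
      | zero => simp
      | add a b iha ihb => simp only [map_add, iha, ihb]
      | @homogeneous n b =>
        have h : decomposeBar k X (toBar k X b) =
            DirectSum.lof k ℕ (fun n => gradeBar k X n) n (toBarGrade k X n b) := by
          change toBarTotal k X (DirectSum.decomposeLinearEquiv _ (b : B k X)) = _
          rw [DirectSum.decomposeLinearEquiv_apply_coe, toBarTotal_lof]
        rw [LinearMap.comp_apply, h]
        simp only [DirectSum.coeLinearMap_lof]
        rfl)
    (by
      refine DirectSum.linearMap_ext _ fun n => LinearMap.ext fun t => ?_
      obtain ⟨_, ⟨b, hb, rfl⟩⟩ := t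
      have h : decomposeBar k X (toBar k X b) =
          DirectSum.lof k ℕ (fun n => gradeBar k X n) n (toBarGrade k X n ⟨b, hb⟩) := by
        change toBarTotal k X (DirectSum.decomposeLinearEquiv _ b) = _
        rw [DirectSum.decomposeLinearEquiv_apply_coe (gradeB k X) n ⟨b, hb⟩, toBarTotal_lof]
      simp only [LinearMap.comp_apply, DirectSum.coeLinearMap_lof]
      rw [h]
      rfl)

variable {X} in
theorem gx_mul_canonical (x : X) (p : StructureMonoid X × List X) :
    gx k x * canonical k p = canonical k (mgen x * p.1, p.2) := by
  simp [canonical, monB_mgen, mul_assoc]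

variable {X} in
theorem toBar_canonical (p : StructureMonoid X × List X) :
    toBar k X (canonical k p) = toBar k X (eWord k p.2) := by
  obtain ⟨m, u⟩ := p
  obtain ⟨w, rfl⟩ := PresentedMonoid.surjective_mk m
  rw [← FreeMonoid.ofList_toList w]
  generalize FreeMonoid.toList w = l
  induction l with
  | nil => simp [canonical]
  | cons x l ih =>
    have : canonical k (PresentedMonoid.mk (StructureRel X) (FreeMonoid.ofList (x :: l)), u) =
        gx k x * canonical k (PresentedMonoid.mk (StructureRel X) (FreeMonoid.ofList l), u) := by
      rw [gx_mul_canonical]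
      rfl
    rw [this, toBar_gx_mul, ih]

/-- Auxiliary: the expansion of an element of `B̄(X)` in the monomials `e_{x_1} ⋯ e_{x_n}`. -/
noncomputable def normalFormBar : BBar k X →ₗ[k] (List X →₀ k) :=
  liftBar k (Finsupp.lmapDomain k k Prod.snd ∘ₗ normalForm k X)
    (fun x b => by
      have : (Finsupp.lmapDomain k k Prod.snd ∘ₗ normalForm k X) ∘ₗ
          LinearMap.mulLeft k (gx k x) = Finsupp.lmapDomain k k Prod.snd ∘ₗ normalForm k X :=
        (basisB k X).ext fun p => by
          simp [basisB_apply, gx_mul_canonical, normalForm_canonical]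
      exact LinearMap.congr_fun this b)

/-- The basis of `B̄(X)` given by the monomials `e_{x_1} ⋯ e_{x_n}`. -/
noncomputable def basisBar : Module.Basis (List X) k (BBar k X) :=
  Module.Basis.ofRepr
    { normalFormBar k X with
      invFun := Finsupp.linearCombination k fun u => toBar k X (eWord k u)
      left_inv := by
        intro t
        obtain ⟨b, rfl⟩ := toBar_surjective k X t
        suffices h : (Finsupp.linearCombination k fun u => toBar k X (eWord k u)) ∘ₗ
            normalFormBar k X ∘ₗ toBar k X = toBar k X from LinearMap.congr_fun h b
        refine (basisB k X).ext fun p => ?_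
        change Finsupp.linearCombination k (fun u => toBar k X (eWord k u))
          (Finsupp.mapDomain Prod.snd (normalForm k X (basisB k X p))) = toBar k X (basisB k X p)
        rw [basisB_apply, normalForm_canonical, Finsupp.mapDomain_single,
          Finsupp.linearCombination_single, one_smul, toBar_canonical]
      right_inv := fun n => by
        change normalFormBar k X (Finsupp.linearCombination k _ n) = n
        induction n using Finsupp.induction_linear with
        | zero => simp
        | add a b iha ihb => simp only [map_add, iha, ihb]
        | single u r =>
          have : normalFormBar k X (toBar k X (eWord k u)) = Finsupp.single u 1 := by
            change Finsupp.mapDomain Prod.snd (normalForm k X (eWord k u)) = _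
            have h : eWord k u = canonical k (1, u) := by simp [canonical]
            rw [h, normalForm_canonical, Finsupp.mapDomain_single]
          simp [this] }

theorem basisBar_apply (u : List X) : basisBar k X u = toBar k X (eWord k u) := by
  refine (basisBar k X).repr.injective ?_
  rw [Module.Basis.repr_self]
  change _ = Finsupp.mapDomain Prod.snd (normalForm k X (eWord k u))
  have h : eWord k u = canonical k (1, u) := by simp [canonical]
  rw [h, normalForm_canonical, Finsupp.mapDomain_single]

end Quotient

/-! ### Rack cochains -/

section Faces

variable {X : Type v} [Shelf X]

/-- `(x_1, …, x_{n+1}) ↦ (x_1, …, x̂_i, …, x_{n+1})`. -/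
def face0 {n : ℕ} (i : Fin (n + 1)) (x : Fin (n + 1) → X) : Fin n → X :=
  fun j => x (i.succAbove j)

/-- `(x_1, …, x_{n+1}) ↦ (x_1 ◁ x_i, …, x_{i-1} ◁ x_i, x_{i+1}, …, x_{n+1})`. -/
def face1 {n : ℕ} (i : Fin (n + 1)) (x : Fin (n + 1) → X) : Fin n → X :=
  fun j => if j.castSucc < i then rop (x j.castSucc) (x i) else x j.succ

end Faces

section Cochains

variable (k : Type u) [CommRing k] (X : Type v) [Shelf X]

/-- The basis `X^n` of `C_n(X)`. -/
abbrev Ind (n : ℕ) : Type v := Fin n → X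

/-- The basis `M(X) × X^n` of `C_n(X, M(X))`. -/
abbrev IndM (n : ℕ) : Type v := StructureMonoid X × (Fin n → X)

/-- The differential of `C^n(X) = k^{X^n}`, dual to
`∂(x_1 ⋯ x_n) = ∑_i (-1)^{i-1} (x_1 ⋯ x̂_i ⋯ x_n - x_1^{x_i} ⋯ x_{i-1}^{x_i} x_{i+1} ⋯ x_n)`. -/
def rackDiff (n : ℕ) : (Ind X n → k) →ₗ[k] (Ind X (n + 1) → k) where
  toFun f x := ∑ i : Fin (n + 1), (-1 : k) ^ (i : ℕ) * (f (face0 i x) - f (face1 i x))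
  map_add' f g := by
    funext x
    simp only [Pi.add_apply, ← Finset.sum_add_distrib]
    exact Finset.sum_congr rfl fun i _ => by ring
  map_smul' r f := by
    funext x
    simp only [Pi.smul_apply, smul_eq_mul, RingHom.id_apply, Finset.mul_sum]
    exact Finset.sum_congr rfl fun i _ => by ring

/-- The differential of `C^n(X, M(X))`, dual to `∂(m x_1 ⋯ x_n) =
∑_i (-1)^{i-1} (m x_1 ⋯ x̂_i ⋯ x_n - m x_i x_1^{x_i} ⋯ x_{i-1}^{x_i} x_{i+1} ⋯ x_n)`. -/
def rackDiffM (n : ℕ) : (IndM X n → k) →ₗ[k] (IndM X (n + 1) → k) where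
  toFun f p := ∑ i : Fin (n + 1), (-1 : k) ^ (i : ℕ) *
    (f (p.1, face0 i p.2) - f (p.1 * mgen (p.2 i), face1 i p.2))
  map_add' f g := by
    funext x
    simp only [Pi.add_apply, ← Finset.sum_add_distrib]
    exact Finset.sum_congr rfl fun i _ => by ring
  map_smul' r f := by
    funext x
    simp only [Pi.smul_apply, smul_eq_mul, RingHom.id_apply, Finset.mul_sum]
    exact Finset.sum_congr rfl fun i _ => by ring

/-- The element `e_{x_1} ⋯ e_{x_n}` of `B̄(X)` corresponding to `x_1 ⋯ x_n ∈ C_n(X)`. -/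
noncomputable def chainBar (n : ℕ) (x : Ind X n) : BBar k X := toBar k X (eWord k (List.ofFn x))

/-- The element `m e_{x_1} ⋯ e_{x_n}` of `B(X)` corresponding to `m x_1 ⋯ x_n ∈ C_n(X, M(X))`. -/
noncomputable def chainB (n : ℕ) (p : IndM X n) : B k X := canonical k (p.1, List.ofFn p.2)

/-- The functional on `B̄(X)` corresponding to a cochain `f ∈ C^n(X)`: it sends
`e_{x_1} ⋯ e_{x_n}` to `f(x_1, …, x_n)` and vanishes in degrees other than `n`. -/
noncomputable def functionalBar (n : ℕ) : (Ind X n → k) →ₗ[k] Module.Dual k (BBar k X) :=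
  ((basisBar k X).constr k).toLinearMap ∘ₗ
    LinearMap.pi fun u : List X => if h : n = u.length
      then LinearMap.proj (fun i => u.get (i.cast h)) else 0

/-- The functional on `B(X)` corresponding to a cochain `f ∈ C^n(X, M(X))`: it sends
`m e_{x_1} ⋯ e_{x_n}` to `f(m, x_1, …, x_n)` and vanishes in degrees other than `n`. -/
noncomputable def functionalB (n : ℕ) : (IndM X n → k) →ₗ[k] Module.Dual k (B k X) :=
  ((basisB k X).constr k).toLinearMap ∘ₗ
    LinearMap.pi fun p : StructureMonoid X × List X => if h : n = p.2.length
      then LinearMap.proj (p.1, fun i => p.2.get (i.cast h)) else 0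

end Cochains

/-! ### Products and homotopies on cochain complexes -/

section Cohomology

variable {k : Type u} [CommRing k] {V : Type v} [AddCommGroup V] [Module k V]

/-- The cohomology `ker d / im d` of a (total) complex. -/
def Cohomology (d : V →ₗ[k] V) : Type v :=
  LinearMap.ker d ⧸ (LinearMap.range d).comap (LinearMap.ker d).subtype

instance (d : V →ₗ[k] V) : AddCommGroup (Cohomology d) :=
  inferInstanceAs (AddCommGroup (LinearMap.ker d ⧸
    (LinearMap.range d).comap (LinearMap.ker d).subtype))

instance (d : V →ₗ[k] V) : Module k (Cohomology d) :=
  inferInstanceAs (Module k (LinearMap.ker d ⧸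
    (LinearMap.range d).comap (LinearMap.ker d).subtype))

/-- The cohomology class of a cocycle. -/
def classOf (d : V →ₗ[k] V) : LinearMap.ker d →ₗ[k] Cohomology d :=
  Submodule.mkQ ((LinearMap.range d).comap (LinearMap.ker d).subtype)

/-- `m` is the product induced in cohomology by the product `c` of cochains. -/
def IsInducedProduct (d : V →ₗ[k] V) (c : V ⊗[k] V →ₗ[k] V)
    (m : Cohomology d →ₗ[k] Cohomology d →ₗ[k] Cohomology d) : Prop :=
  ∀ f g : LinearMap.ker d, ∃ h : c ((f : V) ⊗ₜ (g : V)) ∈ LinearMap.ker d,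
    m (classOf d f) (classOf d g) = classOf d ⟨_, h⟩

end Cohomology

section Total

variable {k : Type u} [CommRing k]

/-- The map `f ⊗ g ↦ μ (f ⊗ g) Θ` on cochains of degrees `p` and `q`, evaluated on the chains of
degree `n`, for a linear map `Θ : V → V ⊗ V`.  Here `V` is a chain complex in which the basis chains
of degree `n` are `chain n i`, `functional` turns cochains into functionals on `V`, and the sign
`(-1)^{pq}` is the Koszul sign of `(f ⊗ g)(a ⊗ b) = (-1)^{|g||a|} f(a) g(b)`. -/
noncomputable def convolution {V : Type*} [AddCommGroup V] [Module k V] {I : ℕ → Type*}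
    (chain : ∀ n, I n → V) (functional : ∀ n, (I n → k) →ₗ[k] Module.Dual k V)
    (Θ : V →ₗ[k] V ⊗[k] V) (p q n : ℕ) : (I p → k) →ₗ[k] (I q → k) →ₗ[k] (I n → k) :=
  LinearMap.mk₂ k
    (fun f g i => (-1 : k) ^ (p * q) *
      LinearMap.mul' k k (TensorProduct.map (functional p f) (functional q g) (Θ (chain n i))))
    (fun f f' g => by funext i; simp [TensorProduct.map_add_left, mul_add])
    (fun r f g => by funext i; simp [TensorProduct.map_smul_left, mul_left_comm])
    (fun f g g' => by funext i; simp [TensorProduct.map_add_right, mul_add])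
    (fun r f g => by funext i; simp [TensorProduct.map_smul_right, mul_left_comm])

/-- The total complex `⨁ C^n` of a family of cochain modules `C^n = k^{I n}`. -/
abbrev Total (k : Type u) [CommRing k] (I : ℕ → Type v) : Type (max u v) := ⨁ n, (I n → k)

variable (I : ℕ → Type v)

/-- The homogeneous element of the total complex given by a cochain of degree `n`. -/
noncomputable def homog (n : ℕ) : (I n → k) →ₗ[k] Total k I :=
  DirectSum.lof k ℕ (fun n => I n → k) n

/-- The differential of the total complex. -/
noncomputable def totalDiff (δ : ∀ n, (I n → k) →ₗ[k] (I (n + 1) → k)) :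
    Total k I →ₗ[k] Total k I :=
  DirectSum.toModule k ℕ _ fun n => homog I (n + 1) ∘ₗ δ n

/-- The map on the tensor square of the total complex given by bilinear maps
`C^p × C^q → C^{r p q}`. -/
noncomputable def totalProd (r : ℕ → ℕ → ℕ)
    (c : ∀ p q, (I p → k) →ₗ[k] (I q → k) →ₗ[k] (I (r p q) → k)) :
    Total k I ⊗[k] Total k I →ₗ[k] Total k I :=
  TensorProduct.lift <| DirectSum.toModule k ℕ _ fun p =>
    (DirectSum.toModule k ℕ _ fun q => ((c p q).compr₂ (homog I (r p q))).flip).flip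

/-- The signed flip `τ(f ⊗ g) = (-1)^{|f||g|} g ⊗ f` of the total complex. -/
noncomputable def totalFlip : Total k I ⊗[k] Total k I →ₗ[k] Total k I ⊗[k] Total k I :=
  (TensorProduct.gradedComm k (fun n => I n → k) (fun n => I n → k)).toLinearMap

/-- The differential `f ⊗ g ↦ (-1)^{|g|} δ f ⊗ g + f ⊗ δ g` of the tensor square of the total
complex.  Its sign is the one for which the cup product is a morphism of complexes when the
differential of cochains is `δ f = f ∘ ∂` (without a sign). -/
noncomputable def totalTensorDiff (δ : ∀ n, (I n → k) →ₗ[k] (I (n + 1) → k)) :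
    Total k I ⊗[k] Total k I →ₗ[k] Total k I ⊗[k] Total k I :=
  TensorProduct.map (totalDiff I δ) (DirectSum.lmap fun n : ℕ => ((-1 : k) ^ n) • LinearMap.id) +
    TensorProduct.map LinearMap.id (totalDiff I δ)

/-- Graded commutativity of a product `m` in the cohomology of the total complex:
`a b = (-1)^{pq} b a` for classes `a` of degree `p` and `b` of degree `q`. -/
def IsGradedCommutative (δ : ∀ n, (I n → k) →ₗ[k] (I (n + 1) → k))
    (m : Cohomology (totalDiff I δ) →ₗ[k] Cohomology (totalDiff I δ) →ₗ[k]
      Cohomology (totalDiff I δ)) : Prop :=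
  ∀ (p q : ℕ) (f g : LinearMap.ker (totalDiff I δ)),
    (f : Total k I) ∈ LinearMap.range (homog (k := k) I p) →
    (g : Total k I) ∈ LinearMap.range (homog (k := k) I q) →
    m (classOf (totalDiff I δ) f) (classOf (totalDiff I δ) g) =
      (-1 : k) ^ (p * q) • m (classOf (totalDiff I δ) g) (classOf (totalDiff I δ) f)

end Total

section Cup

variable (k : Type u) [CommRing k] (X : Type v) [Shelf X]

/-- The cup product `f ⌣ g = μ (f ⊗ g) Δ` on `C^•(X)`, with the coproduct of `B̄(X)`. -/
noncomputable def cup : Total k (Ind X) ⊗[k] Total k (Ind X) →ₗ[k] Total k (Ind X) :=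
  totalProd _ (fun p q => p + q) fun p q =>
    convolution (chainBar k X) (functionalBar k X) (coprodBar k X) p q (p + q)

/-- The cup product `f ⌣ g = μ (f ⊗ g) Δ` on `C^•(X, M(X))`, with the coproduct of `B(X)`. -/
noncomputable def cupM : Total k (IndM X) ⊗[k] Total k (IndM X) →ₗ[k] Total k (IndM X) :=
  totalProd _ (fun p q => p + q) fun p q =>
    convolution (chainB k X) (functionalB k X) (coprodLin k X) p q (p + q)

/-- The degree `-1` map `H(f ⊗ g) = μ (f ⊗ g) h` on the tensor square of `C^•(X)` given by a degree
`1` map `h : B̄(X) → B̄(X) ⊗ B̄(X)`.  For `p = q = 0`, where the truncated `p + q - 1` is `0`, it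
vanishes if `h` vanishes in degree `0`. -/
noncomputable def cupHomotopy (h : BBar k X →ₗ[k] BBar k X ⊗[k] BBar k X) :
    Total k (Ind X) ⊗[k] Total k (Ind X) →ₗ[k] Total k (Ind X) :=
  totalProd _ (fun p q => p + q - 1) fun p q =>
    convolution (chainBar k X) (functionalBar k X) h p q (p + q - 1)

/-- The degree `-1` map `H(f ⊗ g) = μ (f ⊗ g) h` on the tensor square of `C^•(X, M(X))` given by a
degree `1` map `h : B(X) → B(X) ⊗ B(X)`. -/
noncomputable def cupHomotopyM (h : B k X →ₗ[k] B k X ⊗[k] B k X) :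
    Total k (IndM X) ⊗[k] Total k (IndM X) →ₗ[k] Total k (IndM X) :=
  totalProd _ (fun p q => p + q - 1) fun p q =>
    convolution (chainB k X) (functionalB k X) h p q (p + q - 1)

end Cup

end RackHomotopy

open RackHomotopy
open scoped TensorProduct

/-!
# The cup product in rack cohomology is commutative up to an explicit homotopy

Everything takes place in the differential graded algebra `B(X)` and its signed tensor square, where
`Δ` and `τΔ` are morphisms of algebras and of complexes.  The map `h` is a `(Δ, τΔ)`-derivation: it
satisfies `h(ab) = h(a) Δ(b) ± (τΔ)(a) h(b)`, which says that `b ↦ !![τΔ(±b), h b; 0, Δ b]` is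
multiplicative.  Conversely, the values of such a matrix on the generators (`0` for `x` and
`e_x ⊗ e_x` for `e_x` in the upper right corner) are compatible with the relations of `B(X)`, so
they define an algebra morphism `homotopyMatrix`, and expanding its corner entry on the canonical
monomials gives back the formula that defines `h` (`homotopyB_eq_homotopyEntry`).

Since `d ⊗ Id + Id ⊗ d` is a superderivation of `B(X) ⊗ B(X)` (`diffBB_mul`) commuting with `Δ`, the
map `(d ⊗ Id + Id ⊗ d) h + h d` is a `(Δ, τΔ)`-derivation as well, without sign, and so is
`Δ - τΔ`.  The two agree on the generators, hence everywhere (`diffBB_homotopyB`).  As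
`h(x b) = (x ⊗ x) h(b)`, all of this descends to `B̄(X)`.

Cochains are functionals on `B(X)` and on `B̄(X)`, and the rack differential is the transpose of `d`
because moving `x_i` to the left in `e_{x_1} ⋯ (1 - x_i) ⋯ e_{x_n}` acts on the letters that it
passes (`diffB_eWord`).  This situation is abstracted in `IsChainModel`: an element of the total
complex is determined by its functional, products correspond to `μ (f ⊗ g) Θ`, and so the
identities for `d`, `Δ` and `h` transpose to those for `δ`, `⌣` and `H`
(`IsChainModel.totalDiff_comp_totalProd`, `IsChainModel.totalProd_homotopy`).  The homotopy `H`
makes the product of cohomology classes graded commutative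
(`IsInducedProduct.isGradedCommutative`).
-/

namespace RackHomotopy

open scoped TensorProduct DirectSum

/-! ### Chains and the differential of `B(X)` -/

section Chains

variable (k : Type u) [CommRing k] {X : Type v} [Shelf X]

theorem letter_inl (x : X) : letter k (Sum.inl x : X ⊕ X) = gx k x := rfl

theorem letter_inr (x : X) : letter k (Sum.inr x : X ⊕ X) = ge k x := rfl

theorem word_cons (l : X ⊕ X) (w : List (X ⊕ X)) : word k (l :: w) = letter k l * word k w := by
  simp [word]

theorem eWord_cons (x : X) (w : List X) : eWord k (x :: w) = ge k x * eWord k w := by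
  simp [eWord]

theorem eWord_nil : eWord k ([] : List X) = 1 := by simp [eWord]

theorem monB_mem (m : StructureMonoid X) : monB k X m ∈ gradeB k X 0 := by
  obtain ⟨w, rfl⟩ := PresentedMonoid.surjective_mk m
  induction w using FreeMonoid.inductionOn' with
  | one => simpa using SetLike.GradedOne.one_mem (A := gradeB k X)
  | of_mul x w ih =>
    have h := SetLike.mul_mem_graded (gx_mem k x) ih
    rw [map_mul, map_mul]
    rwa [add_zero] at h

theorem eWord_mem (w : List X) : eWord k w ∈ gradeB k X w.length := by
  induction w with
  | nil => simpa [eWord_nil] using SetLike.GradedOne.one_mem (A := gradeB k X)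
  | cons x w ih =>
    rw [eWord_cons, List.length_cons, add_comm]
    exact SetLike.mul_mem_graded (ge_mem k x) ih

theorem canonical_mem (p : StructureMonoid X × List X) :
    canonical k p ∈ gradeB k X p.2.length := by
  simpa [canonical] using SetLike.mul_mem_graded (monB_mem k p.1) (eWord_mem k p.2)

theorem chainB_mem (n : ℕ) (p : IndM X n) : chainB k X n p ∈ gradeB k X n := by
  simpa [chainB] using canonical_mem k (p.1, List.ofFn p.2)

/-- Rewriting a word by the relations brings it to canonical form without changing its degree. -/
theorem exists_word_eq_canonical (w : List (X ⊕ X)) :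
    ∃ p : StructureMonoid X × List X,
      p.2.length = w.countP Sum.isRight ∧ word k w = canonical k p := by
  induction w using List.reverseRecOn with
  | nil => exact ⟨(1, []), rfl, by simp [word, canonical, eWord]⟩
  | append_singleton w l ih =>
    obtain ⟨p, hp, hw⟩ := ih
    have hl : word k (w ++ [l]) = canonical k p * letter k l := by simp [← hw, word]
    rcases l with x | x
    · refine ⟨actX x p, by simp [actX, hp], ?_⟩
      rw [hl, letter_inl]
      simp [canonical, actX, monB_mgen, mul_assoc, eWord_mul_gx]
    · refine ⟨actE x p, by simp [actE, hp], ?_⟩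
      rw [hl, letter_inr]
      simp [canonical, actE, eWord, mul_assoc]

theorem canonical_eq_chainB (p : StructureMonoid X × List X) :
    canonical k p = chainB k X p.2.length (p.1, p.2.get) := by
  simp [chainB, canonical]

theorem gradeB_eq_span_chainB (n : ℕ) :
    gradeB k X n = Submodule.span k (Set.range (chainB k X n)) := by
  apply le_antisymm
  · rw [gradeB, Submodule.span_le]
    rintro _ ⟨w, rfl, rfl⟩
    obtain ⟨p, hp, hw⟩ := exists_word_eq_canonical k w
    rw [hw, ← hp, canonical_eq_chainB]
    exact Submodule.subset_span ⟨_, rfl⟩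
  · rw [Submodule.span_le]
    rintro _ ⟨p, rfl⟩
    exact chainB_mem k n p

omit [Shelf X] in
theorem face0_zero {n : ℕ} (x : Fin (n + 1) → X) : face0 0 x = Fin.tail x := by
  funext j
  simp [face0, Fin.tail]

theorem face1_zero {n : ℕ} (x : Fin (n + 1) → X) : face1 0 x = Fin.tail x := by
  funext j
  simp [face1, Fin.tail]

omit [Shelf X] in
theorem face0_succ {n : ℕ} (i : Fin (n + 1)) (x : Fin (n + 2) → X) :
    face0 i.succ x = Fin.cons (x 0) (face0 i (Fin.tail x)) := by
  funext j
  refine Fin.cases ?_ (fun j => ?_) j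
  · simp [face0]
  · simp [face0, Fin.tail]

theorem face1_succ {n : ℕ} (i : Fin (n + 1)) (x : Fin (n + 2) → X) :
    face1 i.succ x = Fin.cons (rop (x 0) (x i.succ)) (face1 i (Fin.tail x)) := by
  funext j
  refine Fin.cases ?_ (fun j => ?_) j
  · simp [face1]
  · simp [face1, Fin.tail]

theorem diffB_one : diffB k X 1 = 0 := by
  have h := diffB_mul k (SetLike.GradedOne.one_mem (A := gradeB k X)) (1 : B k X)
  simpa using h

theorem diffB_monB_mul (m : StructureMonoid X) (b : B k X) :
    diffB k X (monB k X m * b) = monB k X m * diffB k X b := by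
  obtain ⟨w, rfl⟩ := PresentedMonoid.surjective_mk m
  induction w using FreeMonoid.inductionOn' generalizing b with
  | one => simp
  | of_mul x w ih =>
    have h : monB k X (PresentedMonoid.mk (StructureRel X) (FreeMonoid.of x)) = gx k x := rfl
    rw [map_mul (PresentedMonoid.mk _), map_mul (monB k X), h, mul_assoc, mul_assoc,
      diffB_mul k (gx_mem k x), ih, diffB_gx]
    simp

/-- The differential of `B(X)` is the rack differential on monomials: in
`e_{x_1} ⋯ (1 - x_i) ⋯ e_{x_n}` the letter `x_i` is moved to the left by the relations. -/
theorem diffB_eWord (n : ℕ) (x : Fin (n + 1) → X) :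
    diffB k X (eWord k (List.ofFn x)) = ∑ i : Fin (n + 1), (-1 : k) ^ (i : ℕ) •
      (eWord k (List.ofFn (face0 i x)) - gx k (x i) * eWord k (List.ofFn (face1 i x))) := by
  induction n with
  | zero => simp [eWord, diffB_ge]
  | succ n ih =>
    have hx : List.ofFn x = x 0 :: List.ofFn (Fin.tail x) := by
      rw [List.ofFn_succ]
      rfl
    rw [hx, eWord_cons, diffB_mul k (ge_mem k _), ih, diffB_ge, Fin.sum_univ_succ (n := n + 1),
      face0_zero, face1_zero, Finset.mul_sum, Finset.smul_sum, sub_mul, one_mul]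
    simp only [Fin.val_zero, pow_zero, one_smul, add_right_inj]
    refine Finset.sum_congr rfl fun i _ => ?_
    rw [face0_succ, face1_succ, List.ofFn_cons, List.ofFn_cons, eWord_cons, eWord_cons,
      ← mul_assoc (gx k _) (ge k _), gx_mul_ge, mul_smul_comm, smul_smul, mul_sub, mul_assoc,
      Fin.val_succ, add_comm (i : ℕ) 1, pow_add]
    rfl

theorem diffB_chainB (n : ℕ) (p : IndM X (n + 1)) :
    diffB k X (chainB k X (n + 1) p) = ∑ i : Fin (n + 1), (-1 : k) ^ (i : ℕ) •
      (chainB k X n (p.1, face0 i p.2) - chainB k X n (p.1 * mgen (p.2 i), face1 i p.2)) := by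
  rw [chainB, canonical, diffB_monB_mul, diffB_eWord, Finset.mul_sum]
  refine Finset.sum_congr rfl fun i _ => ?_
  simp [chainB, canonical, mul_sub, monB_mgen, mul_assoc]

theorem diffB_chainB_zero (p : IndM X 0) : diffB k X (chainB k X 0 p) = 0 := by
  rw [chainB, canonical, diffB_monB_mul]
  simp [eWord_nil, diffB_one]

theorem diffB_mem_of_succ {n : ℕ} {b : B k X} (hb : b ∈ gradeB k X (n + 1)) :
    diffB k X b ∈ gradeB k X n := by
  rw [gradeB_eq_span_chainB] at hb
  induction hb using Submodule.span_induction with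
  | mem b h =>
    obtain ⟨p, rfl⟩ := h
    rw [diffB_chainB]
    exact Submodule.sum_mem _ fun i _ => Submodule.smul_mem _ _
      (Submodule.sub_mem _ (chainB_mem k _ _) (chainB_mem k _ _))
  | zero => simp
  | add a b _ _ iha ihb => rw [map_add]; exact Submodule.add_mem _ iha ihb
  | smul r a _ ih => rw [map_smul]; exact Submodule.smul_mem _ _ ih

theorem diffB_of_mem_zero {b : B k X} (hb : b ∈ gradeB k X 0) : diffB k X b = 0 := by
  rw [gradeB_eq_span_chainB] at hb
  induction hb using Submodule.span_induction with
  | mem b h =>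
    obtain ⟨p, rfl⟩ := h
    exact diffB_chainB_zero k p
  | zero => simp
  | add a b _ _ iha ihb => simp [iha, ihb]
  | smul r a _ ih => simp [ih]

/-- The differential changes the parity of a homogeneous element.  In degree `0`, where it
vanishes, any odd degree is a degree of the zero element. -/
theorem exists_diffB_mem {n : ℕ} {b : B k X} (hb : b ∈ gradeB k X n) :
    ∃ i, diffB k X b ∈ gradeB k X i ∧ (-1 : k) ^ i = -(-1 : k) ^ n := by
  cases n with
  | zero => exact ⟨1, by simp [diffB_of_mem_zero k hb], by simp⟩
  | succ n => exact ⟨n, diffB_mem_of_succ k hb, by simp [pow_succ]⟩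

end Chains

/-! ### The differential and the grading of the algebra `B(X) ⊗ B(X)` -/

section TensorSquare

variable (k : Type u) [CommRing k] (X : Type v) [Shelf X]

/-- The differential `d ⊗ Id + Id ⊗ d` of the algebra `B(X) ⊗ B(X)`. -/
noncomputable def diffBB : BB k X →ₗ[k] BB k X :=
  (untwist k X).symm.toLinearMap ∘ₗ tensorDiff (gradeB k X) (diffB k X) ∘ₗ
    (untwist k X).toLinearMap

/-- The degree `n` part of the algebra `B(X) ⊗ B(X)`. -/
noncomputable def gradeBB (n : ℕ) : Submodule k (BB k X) :=
  Submodule.span k {t | ∃ i j : ℕ, i + j = n ∧ ∃ a ∈ gradeB k X i, ∃ b ∈ gradeB k X j,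
    tm k a b = t}

variable {X}

theorem tm_add_left (a a' b : B k X) : tm k (a + a') b = tm k a b + tm k a' b :=
  (untwist k X).injective (by simp [untwist_tm, TensorProduct.add_tmul])

theorem tm_add_right (a b b' : B k X) : tm k a (b + b') = tm k a b + tm k a b' :=
  (untwist k X).injective (by simp [untwist_tm, TensorProduct.tmul_add])

theorem tm_sub_left (a a' b : B k X) : tm k (a - a') b = tm k a b - tm k a' b :=
  (untwist k X).injective (by simp [untwist_tm, TensorProduct.sub_tmul])

theorem tm_sub_right (a b b' : B k X) : tm k a (b - b') = tm k a b - tm k a b' :=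
  (untwist k X).injective (by simp [untwist_tm, TensorProduct.tmul_sub])

theorem tm_smul_left (r : k) (a b : B k X) : tm k (r • a) b = r • tm k a b :=
  (untwist k X).injective (by simp [untwist_tm, TensorProduct.smul_tmul'])

theorem tm_smul_right (r : k) (a b : B k X) : tm k a (r • b) = r • tm k a b :=
  (untwist k X).injective (by simp [untwist_tm, TensorProduct.tmul_smul])

theorem tm_zero_left (b : B k X) : tm k 0 b = 0 := by simp [tm]

theorem tm_zero_right (a : B k X) : tm k a 0 = 0 := by simp [tm]

theorem tm_one_one : tm k (1 : B k X) 1 = 1 := rfl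

theorem BB_induction {P : BB k X → Prop} (zero : P 0) (add : ∀ s t, P s → P t → P (s + t))
    (tmul : ∀ (i j : ℕ) (a b : B k X), a ∈ gradeB k X i → b ∈ gradeB k X j → P (tm k a b))
    (t : BB k X) : P t := by
  obtain ⟨t, rfl⟩ := (untwist k X).symm.surjective t
  induction t using TensorProduct.induction_on with
  | zero => simpa using zero
  | add s t ihs iht => simpa using add _ _ ihs iht
  | tmul a b =>
    change P (tm k a b)
    induction a using DirectSum.Decomposition.inductionOn (gradeB k X) with
    | zero => simpa [tm_zero_left] using zero
    | add a a' iha iha' => rw [tm_add_left]; exact add _ _ iha iha'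
    | @homogeneous i a =>
      induction b using DirectSum.Decomposition.inductionOn (gradeB k X) with
      | zero => simpa [tm_zero_right] using zero
      | add a a' iha iha' => rw [tm_add_right]; exact add _ _ iha iha'
      | @homogeneous j b => exact tmul i j a b a.2 b.2

theorem diffBB_tm {i : ℕ} {a : B k X} (ha : a ∈ gradeB k X i) (b : B k X) :
    diffBB k X (tm k a b) = tm k (diffB k X a) b + (-1 : k) ^ i • tm k a (diffB k X b) := by
  rw [← tm_smul_left, ← parity_of_mem (gradeB k X) ha]
  rfl

theorem tm_mem {i j : ℕ} {a b : B k X} (ha : a ∈ gradeB k X i) (hb : b ∈ gradeB k X j) :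
    tm k a b ∈ gradeBB k X (i + j) :=
  Submodule.subset_span ⟨i, j, rfl, a, ha, b, hb, rfl⟩

theorem untwist_mem {n : ℕ} {t : BB k X} (ht : t ∈ gradeBB k X n) :
    untwist k X t ∈ tensorGrade (gradeB k X) n := by
  induction ht using Submodule.span_induction with
  | mem t h =>
    obtain ⟨i, j, hn, a, ha, b, hb, rfl⟩ := h
    exact Submodule.subset_span ⟨i, j, hn, a, ha, b, hb, rfl⟩
  | zero => simp
  | add a b _ _ iha ihb => rw [map_add]; exact Submodule.add_mem _ iha ihb
  | smul r a _ ih => rw [map_smul]; exact Submodule.smul_mem _ _ ih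

instance : SetLike.GradedMonoid (gradeBB k X) where
  one_mem := by
    have h := tm_mem k (SetLike.GradedOne.one_mem (A := gradeB k X))
      (SetLike.GradedOne.one_mem (A := gradeB k X))
    rwa [tm_one_one, add_zero] at h
  mul_mem := by
    intro m n s t hs ht
    have h : gradeBB k X m * gradeBB k X n ≤ gradeBB k X (m + n) := by
      rw [gradeBB, gradeBB, Submodule.span_mul_span, Submodule.span_le]
      rintro _ ⟨_, ⟨i, j, rfl, a, ha, b, hb, rfl⟩, _, ⟨i', j', rfl, a', ha', b', hb', rfl⟩, rfl⟩
      have h := Submodule.smul_mem _ ((-1 : k) ^ (j * i'))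
        (tm_mem k (SetLike.mul_mem_graded ha ha') (SetLike.mul_mem_graded hb hb'))
      rw [← tm_mul_tm k hb ha', add_add_add_comm] at h
      exact h
    exact h (Submodule.mul_mem_mul hs ht)

/-- The differential of `B(X) ⊗ B(X)` is a superderivation. -/
theorem diffBB_mul {n : ℕ} {s : BB k X} (hs : s ∈ gradeBB k X n) (t : BB k X) :
    diffBB k X (s * t) = diffBB k X s * t + (-1 : k) ^ n • (s * diffBB k X t) := by
  induction hs using Submodule.span_induction with
  | zero => simp
  | add a b _ _ iha ihb => simp only [add_mul, map_add, iha, ihb, smul_add]; abel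
  | smul r a _ ih => simp only [smul_mul_assoc, map_smul, ih, smul_add, smul_comm r]
  | mem s h =>
    obtain ⟨i, j, rfl, a, ha, b, hb, rfl⟩ := h
    induction t using BB_induction with
    | zero => simp
    | add s t ihs iht => simp only [mul_add, map_add, ihs, iht, smul_add]; abel
    | tmul i' j' a' b' ha' hb' =>
      obtain ⟨m, hm, hm'⟩ := exists_diffB_mem k hb
      obtain ⟨m', hn, hn'⟩ := exists_diffB_mem k ha'
      -- the Koszul signs of `d b` and `d a'`, whose degrees are those of `b` and `a'` up to parity
      have e₁ : (-1 : k) ^ (m * i') = (-1) ^ i' * (-1) ^ (j * i') := by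
        rw [pow_mul, hm', neg_pow ((-1 : k) ^ j), pow_mul]
      have e₂ : (-1 : k) ^ j * (-1) ^ (j * m') = (-1) ^ (j * i') := by
        rw [mul_comm j m', pow_mul, hn', neg_pow ((-1 : k) ^ i'), ← pow_mul, mul_comm i' j,
          ← mul_assoc, ← pow_add, Even.neg_one_pow ⟨j, rfl⟩, one_mul]
      rw [tm_mul_tm k hb ha', map_smul, diffBB_tm k (SetLike.mul_mem_graded ha ha'),
        diffBB_tm k ha, diffBB_tm k ha', diffB_mul k ha, diffB_mul k hb, mul_add, add_mul,
        smul_mul_assoc, mul_smul_comm, tm_mul_tm k hb ha', tm_mul_tm k hm ha',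
        tm_mul_tm k hb hn, tm_mul_tm k hb ha', tm_add_left, tm_add_right, tm_smul_left,
        tm_smul_right]
      simp only [smul_add, smul_smul, e₁, e₂, pow_add, mul_assoc]
      module

end TensorSquare

/-! ### The coproduct and its opposite -/

section Coproduct

variable (k : Type u) [CommRing k] {X : Type v} [Shelf X]

theorem coprod_gx (x : X) : coprod k X (gx k x) = tm k (gx k x) (gx k x) := liftB_gx ..

theorem coprod_ge (x : X) :
    coprod k X (ge k x) = tm k (ge k x) (gx k x) + tm k 1 (ge k x) := liftB_ge ..

theorem flipB_tm {i j : ℕ} {a b : B k X} (ha : a ∈ gradeB k X i) (hb : b ∈ gradeB k X j) :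
    flipB k X (tm k a b) = (-1 : k) ^ (i * j) • tm k b a :=
  (untwist k X).injective <| by
    rw [untwist_flipB, untwist_tm, signedFlip_tmul _ ha hb, map_smul, untwist_tm]

theorem flipB_coprod_gx (x : X) :
    flipB k X (coprod k X (gx k x)) = tm k (gx k x) (gx k x) := by
  rw [coprod_gx, flipB_tm k (gx_mem k x) (gx_mem k x)]
  simp

theorem flipB_coprod_ge (x : X) :
    flipB k X (coprod k X (ge k x)) = tm k (gx k x) (ge k x) + tm k (ge k x) 1 := by
  rw [coprod_ge, map_add, flipB_tm k (ge_mem k x) (gx_mem k x),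
    flipB_tm k (SetLike.GradedOne.one_mem (A := gradeB k X)) (ge_mem k x)]
  simp

theorem coprod_letter_mem (l : X ⊕ X) :
    coprod k X (letter k l) ∈ gradeBB k X ([l].countP Sum.isRight) := by
  rcases l with x | x
  · rw [letter_inl, coprod_gx]
    simpa using tm_mem k (gx_mem k x) (gx_mem k x)
  · have h := tm_mem k (ge_mem k x) (gx_mem k x)
    have h' := tm_mem k (SetLike.GradedOne.one_mem (A := gradeB k X)) (ge_mem k x)
    rw [add_comm] at h'
    rw [letter_inr, coprod_ge]
    simpa using Submodule.add_mem _ h h'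

theorem flipB_mem {n : ℕ} {t : BB k X} (ht : t ∈ gradeBB k X n) : flipB k X t ∈ gradeBB k X n := by
  induction ht using Submodule.span_induction with
  | mem t h =>
    obtain ⟨i, j, rfl, a, ha, b, hb, rfl⟩ := h
    rw [flipB_tm k ha hb, add_comm]
    exact Submodule.smul_mem _ _ (tm_mem k hb ha)
  | zero => simp
  | add a b _ _ iha ihb => rw [map_add]; exact Submodule.add_mem _ iha ihb
  | smul r a _ ih => rw [map_smul]; exact Submodule.smul_mem _ _ ih

omit [Shelf X] in
theorem countP_cons_eq (l : X ⊕ X) (w : List (X ⊕ X)) :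
    (l :: w).countP Sum.isRight = [l].countP Sum.isRight + w.countP Sum.isRight :=
  List.countP_append (p := Sum.isRight) (l₁ := [l]) (l₂ := w)

theorem letter_mem (l : X ⊕ X) : letter k l ∈ gradeB k X ([l].countP Sum.isRight) := by
  simpa [word] using word_mem k [l]

/-- A property of homogeneous elements of `B(X)` holds if it is linear, holds for `1`, and is
inherited under left multiplication by the generators. -/
theorem gradeB_induction {P : ℕ → B k X → Prop} (zero : ∀ n, P n 0)
    (add : ∀ n a b, P n a → P n b → P n (a + b)) (smul : ∀ n (r : k) a, P n a → P n (r • a))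
    (one : P 0 1)
    (mul : ∀ l n b, b ∈ gradeB k X n → P n b → P ([l].countP Sum.isRight + n) (letter k l * b))
    {n : ℕ} {b : B k X} (hb : b ∈ gradeB k X n) : P n b := by
  induction hb using Submodule.span_induction with
  | mem b h =>
    obtain ⟨w, rfl, rfl⟩ := h
    induction w with
    | nil => simpa [word] using one
    | cons l w ih =>
      rw [word_cons, countP_cons_eq]
      exact mul l _ _ (word_mem k w) ih
  | zero => exact zero n
  | add a b _ _ iha ihb => exact add n a b iha ihb
  | smul r a _ ih => exact smul n r a ih

/-- Linear maps on `B(X)` agree if they agree on `1` and if agreement is inherited under left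
multiplication by the generators. -/
theorem linearMap_ext_B {W : Type*} [AddCommGroup W] [Module k W] {f g : B k X →ₗ[k] W}
    (one : f 1 = g 1) (mul : ∀ l b, f b = g b → f (letter k l * b) = g (letter k l * b)) :
    f = g := by
  ext b
  induction b using DirectSum.Decomposition.inductionOn (gradeB k X) with
  | zero => simp
  | add a b iha ihb => simp [iha, ihb]
  | homogeneous b =>
    exact gradeB_induction k (P := fun _ b => f b = g b) (by simp)
      (fun _ a b ha hb => by simp [ha, hb]) (fun _ r a ha => by simp [ha]) one
      (fun l _ b _ hb => mul l b hb) b.2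

theorem coprod_mem {n : ℕ} {b : B k X} (hb : b ∈ gradeB k X n) :
    coprod k X b ∈ gradeBB k X n := by
  refine gradeB_induction k (P := fun n b => coprod k X b ∈ gradeBB k X n)
    (by simp) (fun n a b ha hb => ?_) (fun n r a ha => ?_) ?_ (fun l n b _ ih => ?_) hb
  · rw [map_add]; exact Submodule.add_mem _ ha hb
  · rw [map_smul]; exact Submodule.smul_mem _ _ ha
  · rw [map_one]; exact SetLike.GradedOne.one_mem (A := gradeBB k X)
  · rw [map_mul]; exact SetLike.mul_mem_graded (coprod_letter_mem k l) ih

theorem diffBB_one : diffBB k X 1 = 0 := by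
  rw [← tm_one_one, diffBB_tm k (SetLike.GradedOne.one_mem (A := gradeB k X)), diffB_one]
  simp [tm_zero_left, tm_zero_right]

theorem diffBB_coprod_letter (l : X ⊕ X) :
    diffBB k X (coprod k X (letter k l)) = coprod k X (diffB k X (letter k l)) := by
  rcases l with x | x
  · rw [letter_inl, coprod_gx, diffBB_tm k (gx_mem k x), diffB_gx]
    simp [tm_zero_left, tm_zero_right]
  · rw [letter_inr, coprod_ge, map_add, diffBB_tm k (ge_mem k x),
      diffBB_tm k (SetLike.GradedOne.one_mem (A := gradeB k X)), diffB_ge, diffB_gx, diffB_one,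
      map_sub, map_one, coprod_gx, tm_sub_left, tm_sub_right, tm_one_one]
    simp [tm_zero_left, tm_zero_right]

/-- The coproduct is a morphism of complexes. -/
theorem diffBB_coprod (b : B k X) :
    diffBB k X (coprod k X b) = coprod k X (diffB k X b) := by
  have h : diffBB k X ∘ₗ (coprod k X).toLinearMap = (coprod k X).toLinearMap ∘ₗ diffB k X := by
    refine linearMap_ext_B k (by simp [diffBB_one, diffB_one]) fun l b ih => ?_
    simp only [LinearMap.comp_apply, AlgHom.toLinearMap_apply] at ih ⊢
    rw [map_mul, diffBB_mul k (coprod_letter_mem k l), diffBB_coprod_letter, ih,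
      diffB_mul k (letter_mem k l), map_add, map_smul, map_mul, map_mul]
  exact LinearMap.congr_fun h b

end Coproduct

/-! ### The homotopy `h` on `B(X)` -/

section HomotopyB

variable (k : Type u) [CommRing k] (X : Type v) [Shelf X]

/-- The algebra morphism `b ↦ !![τΔ(±b), h b; 0, Δ b]`.  Multiplicativity of these triangular
matrices is the product formula for `h`; the relations of `B(X)` hold because
`(y ⊗ y)(e_{x^y} ⊗ e_{x^y}) = (e_x ⊗ e_x)(y ⊗ y)`. -/
noncomputable def homotopyMatrix : B k X →ₐ[k] Matrix (Fin 2) (Fin 2) (BB k X) :=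
  liftB (fun x => !![tm k (gx k x) (gx k x), 0; 0, tm k (gx k x) (gx k x)])
    (fun x => !![-flipB k X (coprod k X (ge k x)), tm k (ge k x) (ge k x);
      0, coprod k X (ge k x)])
    (fun x y => by
      have h := congrArg (coprod k X) (gx_mul_gx k x y)
      simp only [map_mul, coprod_gx] at h
      simp [h])
    (fun x y => by
      have h := congrArg (coprod k X) (gx_mul_ge k x y)
      have h' := congrArg (flipB k X) h
      have h'' : tm k (gx k y) (gx k y) * tm k (ge k (rop x y)) (ge k (rop x y)) =
          tm k (ge k x) (ge k x) * tm k (gx k y) (gx k y) := by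
        rw [tm_mul_tm k (gx_mem k _) (ge_mem k _), tm_mul_tm k (ge_mem k _) (gx_mem k _),
          gx_mul_ge]
      rw [map_mul, map_mul, map_mul, map_mul, flipB_coprod_gx] at h'
      rw [map_mul, map_mul, coprod_gx] at h
      simp [h, h', h''])

/-- The upper right entry of `homotopyMatrix`. -/
noncomputable def homotopyEntry : B k X →ₗ[k] BB k X :=
  (Matrix.entryLinearMap k (BB k X) 0 1) ∘ₗ (homotopyMatrix k X).toLinearMap

variable {X}

theorem homotopyMatrix_apply (b : B k X) :
    homotopyMatrix k X b = !![flipB k X (coprod k X (signB k X b)), homotopyEntry k X b;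
      0, coprod k X b] := by
  have key : ∀ b : B k X, homotopyMatrix k X b 0 0 = flipB k X (coprod k X (signB k X b)) ∧
      homotopyMatrix k X b 1 0 = 0 ∧ homotopyMatrix k X b 1 1 = coprod k X b := by
    intro b
    induction b using B_induction with
    | h0 r => simp [Matrix.algebraMap_matrix_apply]
    | hx x =>
      have h : signB k X (gx k x) = gx k x := liftB_gx ..
      simp [homotopyMatrix, h, ← coprod_gx, flipB_coprod_gx]
    | he x =>
      have h : signB k X (ge k x) = -ge k x := liftB_ge ..
      simp [homotopyMatrix, h]
    | hm a b iha ihb => simp [Matrix.mul_apply, iha, ihb]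
    | ha a b iha ihb => simp [iha, ihb]
  obtain ⟨h1, h2, h3⟩ := key b
  ext i j
  fin_cases i <;> fin_cases j
  · exact h1
  · rfl
  · exact h2
  · exact h3

theorem homotopyEntry_mul {i : ℕ} {a : B k X} (ha : a ∈ gradeB k X i) (b : B k X) :
    homotopyEntry k X (a * b) = homotopyEntry k X a * coprod k X b +
      (-1 : k) ^ i • (flipB k X (coprod k X a) * homotopyEntry k X b) := by
  have h : homotopyEntry k X (a * b) = homotopyMatrix k X (a * b) 0 1 := rfl
  rw [h, map_mul, homotopyMatrix_apply, homotopyMatrix_apply, signB_of_mem k ha]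
  simp [Matrix.mul_apply, add_comm]

theorem homotopyEntry_gx (x : X) : homotopyEntry k X (gx k x) = 0 := by
  simp [homotopyEntry, homotopyMatrix]

theorem homotopyEntry_ge (x : X) : homotopyEntry k X (ge k x) = tm k (ge k x) (ge k x) := by
  simp [homotopyEntry, homotopyMatrix]

theorem homotopyEntry_one : homotopyEntry k X 1 = 0 := by
  simp [homotopyEntry]

theorem coprod_monB (m : StructureMonoid X) :
    coprod k X (monB k X m) = tm k (monB k X m) (monB k X m) := by
  obtain ⟨w, rfl⟩ := PresentedMonoid.surjective_mk m
  induction w using FreeMonoid.inductionOn' with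
  | one => simp [tm_one_one]
  | of_mul x w ih =>
    have h : monB k X (PresentedMonoid.mk (StructureRel X) (FreeMonoid.of x)) = gx k x := rfl
    rw [map_mul (PresentedMonoid.mk _), map_mul (monB k X), h, map_mul, ih, coprod_gx,
      tm_mul_tm k (gx_mem k x) (monB_mem k _)]
    simp

theorem homotopyEntry_monB (m : StructureMonoid X) : homotopyEntry k X (monB k X m) = 0 := by
  obtain ⟨w, rfl⟩ := PresentedMonoid.surjective_mk m
  induction w using FreeMonoid.inductionOn' with
  | one => simp [homotopyEntry_one]
  | of_mul x w ih =>
    have h : monB k X (PresentedMonoid.mk (StructureRel X) (FreeMonoid.of x)) = gx k x := rfl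
    rw [map_mul (PresentedMonoid.mk _), map_mul (monB k X), h, homotopyEntry_mul k (gx_mem k x),
      ih, homotopyEntry_gx]
    simp

theorem homotopyEntry_eWord (w : List X) :
    homotopyEntry k X (eWord k w) = ∑ i : Fin w.length, (-1 : k) ^ (i : ℕ) •
      (flipB k X (coprod k X (eWord k (w.take i))) * tm k (ge k (w.get i)) (ge k (w.get i)) *
        coprod k X (eWord k (w.drop (i + 1)))) := by
  induction w with
  | nil => simp [eWord_nil, homotopyEntry_one]
  | cons x w ih =>
    rw [eWord_cons, homotopyEntry_mul k (ge_mem k x), homotopyEntry_ge, ih]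
    refine Eq.trans ?_ (Fin.sum_univ_succ (n := w.length) _).symm
    rw [Finset.mul_sum, Finset.smul_sum]
    congr 1
    · simp [eWord_nil]
    · refine Finset.sum_congr rfl fun i _ => ?_
      simp [eWord_cons, pow_succ, mul_assoc]

theorem homotopyB_canonical (a : StructureMonoid X) (w : List X) :
    homotopyB k X (monB k X a * eWord k w) =
      ∑ i : Fin w.length, (-1 : k) ^ (i : ℕ) •
        (tm k (monB k X a) (monB k X a) * flipB k X (coprod k X (eWord k (w.take i))) *
          tm k (ge k (w.get i)) (ge k (w.get i)) * coprod k X (eWord k (w.drop (i + 1)))) := by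
  have h := (basisB k X).constr_basis k (fun p : StructureMonoid X × List X =>
    ∑ i : Fin p.2.length, (-1 : k) ^ (i : ℕ) •
      (tm k (monB k X p.1) (monB k X p.1) * flipB k X (coprod k X (eWord k (p.2.take i))) *
        tm k (ge k (p.2.get i)) (ge k (p.2.get i)) * coprod k X (eWord k (p.2.drop (i + 1)))))
    (a, w)
  rw [basisB_apply] at h
  exact h

theorem homotopyB_eq_homotopyEntry : homotopyB k X = homotopyEntry k X := by
  refine (basisB k X).ext fun p => ?_
  rw [basisB_apply, canonical, homotopyB_canonical, homotopyEntry_mul k (monB_mem k _),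
    homotopyEntry_monB, homotopyEntry_eWord, coprod_monB, flipB_tm k (monB_mem k _) (monB_mem k _)]
  simp [Finset.mul_sum, mul_assoc]

/-- The product formula for `h`. -/
theorem homotopyB_mul {i : ℕ} {a : B k X} (ha : a ∈ gradeB k X i) (b : B k X) :
    homotopyB k X (a * b) = homotopyB k X a * coprod k X b +
      (-1 : k) ^ i • (flipB k X (coprod k X a) * homotopyB k X b) := by
  rw [homotopyB_eq_homotopyEntry, homotopyEntry_mul k ha]

theorem homotopyB_gx (x : X) : homotopyB k X (gx k x) = 0 := by
  rw [homotopyB_eq_homotopyEntry, homotopyEntry_gx]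

theorem homotopyB_ge (x : X) : homotopyB k X (ge k x) = tm k (ge k x) (ge k x) := by
  rw [homotopyB_eq_homotopyEntry, homotopyEntry_ge]

theorem homotopyB_one : homotopyB k X 1 = 0 := by
  rw [homotopyB_eq_homotopyEntry, homotopyEntry_one]

theorem homotopyB_letter_mem (l : X ⊕ X) :
    homotopyB k X (letter k l) ∈ gradeBB k X ([l].countP Sum.isRight + 1) := by
  rcases l with x | x
  · rw [letter_inl, homotopyB_gx]
    exact Submodule.zero_mem _
  · rw [letter_inr, homotopyB_ge]
    simpa using tm_mem k (ge_mem k x) (ge_mem k x)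

/-- The map `h` has degree `1`. -/
theorem homotopyB_mem {n : ℕ} {b : B k X} (hb : b ∈ gradeB k X n) :
    homotopyB k X b ∈ gradeBB k X (n + 1) := by
  refine gradeB_induction k (P := fun n b => homotopyB k X b ∈ gradeBB k X (n + 1))
    (by simp) (fun n a b ha hb => ?_) (fun n r a ha => ?_) ?_ (fun l n b hb ih => ?_) hb
  · rw [map_add]; exact Submodule.add_mem _ ha hb
  · rw [map_smul]; exact Submodule.smul_mem _ _ ha
  · rw [homotopyB_one]; exact Submodule.zero_mem _
  · rw [homotopyB_mul k (letter_mem k l)]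
    refine Submodule.add_mem _ ?_ (Submodule.smul_mem _ _ ?_)
    · have h := SetLike.mul_mem_graded (homotopyB_letter_mem k l) (coprod_mem k hb)
      rwa [add_right_comm] at h
    · rw [add_assoc]
      exact SetLike.mul_mem_graded (flipB_mem k (coprod_letter_mem k l)) ih

/-- The homotopy identity on the generators. -/
theorem diffBB_homotopyB_letter (l : X ⊕ X) :
    diffBB k X (homotopyB k X (letter k l)) + homotopyB k X (diffB k X (letter k l)) =
      coprod k X (letter k l) - flipB k X (coprod k X (letter k l)) := by
  rcases l with x | x
  · rw [letter_inl, flipB_coprod_gx, coprod_gx, diffB_gx, homotopyB_gx]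
    simp
  · rw [letter_inr, homotopyB_ge, flipB_coprod_ge, coprod_ge, diffBB_tm k (ge_mem k x), diffB_ge,
      map_sub, homotopyB_one, homotopyB_gx, tm_sub_left, tm_sub_right]
    simp only [pow_one, neg_smul, one_smul]
    abel

theorem diffBB_flipB_coprod_letter (l : X ⊕ X) :
    diffBB k X (flipB k X (coprod k X (letter k l))) =
      flipB k X (coprod k X (diffB k X (letter k l))) := by
  rcases l with x | x
  · rw [letter_inl, flipB_coprod_gx, diffBB_tm k (gx_mem k x), diffB_gx]
    simp [tm_zero_left, tm_zero_right]
  · rw [letter_inr, flipB_coprod_ge, map_add, diffBB_tm k (ge_mem k x),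
      diffBB_tm k (gx_mem k x), diffB_ge, diffB_gx, diffB_one,
      map_sub, map_one, map_sub, flipB_coprod_gx, map_one, tm_sub_left, tm_sub_right, tm_one_one]
    simp [tm_zero_left, tm_zero_right]

/-- The homotopy identity.  Both sides `E` satisfy `E(ab) = E(a) Δ(b) + (τΔ)(a) E(b)`, so that it
is enough to check it on the generators. -/
theorem diffBB_homotopyB (b : B k X) :
    diffBB k X (homotopyB k X b) + homotopyB k X (diffB k X b) =
      coprod k X b - flipB k X (coprod k X b) := by
  have h : diffBB k X ∘ₗ homotopyB k X + homotopyB k X ∘ₗ diffB k X =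
      (coprod k X).toLinearMap -
        (flipB k X).toLinearMap ∘ₗ (coprod k X).toLinearMap := by
    refine linearMap_ext_B k (by simp [homotopyB_one, diffB_one]) fun l b ih => ?_
    simp only [LinearMap.add_apply, LinearMap.sub_apply, LinearMap.comp_apply,
      AlgHom.toLinearMap_apply, AlgEquiv.toLinearMap_apply] at ih ⊢
    have hl := diffBB_homotopyB_letter k l
    -- `d` changes the parity, whence the sign opposite to that of the product formula for `l`
    have hm : homotopyB k X (diffB k X (letter k l) * b) =
        homotopyB k X (diffB k X (letter k l)) * coprod k X b -
          (-1 : k) ^ ([l].countP Sum.isRight) •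
            (flipB k X (coprod k X (diffB k X (letter k l))) * homotopyB k X b) := by
      obtain ⟨m, hm, hm'⟩ := exists_diffB_mem k (letter_mem k l)
      rw [homotopyB_mul k hm, hm', neg_smul, sub_eq_add_neg]
    have hs : (-1 : k) ^ ([l].countP Sum.isRight) * (-1) ^ ([l].countP Sum.isRight) = 1 := by
      rw [← pow_add, Even.neg_one_pow ⟨_, rfl⟩]
    rw [homotopyB_mul k (letter_mem k l), diffB_mul k (letter_mem k l), map_add, map_add, map_smul,
      map_smul, diffBB_mul k (homotopyB_letter_mem k l),
      diffBB_mul k (flipB_mem k (coprod_letter_mem k l)), diffBB_coprod,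
      diffBB_flipB_coprod_letter, hm, homotopyB_mul k (letter_mem k l), map_mul, map_mul,
      eq_sub_of_add_eq hl, eq_sub_of_add_eq ih, pow_succ]
    simp only [smul_add, smul_smul, hs, one_smul, mul_sub, sub_mul, mul_neg, mul_one, neg_smul]
    abel
  exact LinearMap.congr_fun h b

end HomotopyB

/-! ### Convolution of cochains -/

section ChainModel

variable {k : Type u} [CommRing k] {V : Type*} [AddCommGroup V] [Module k V]
  (𝒱 : ℕ → Submodule k V) [DirectSum.Decomposition 𝒱] {I : ℕ → Type v}
  (d : V →ₗ[k] V) (chain : ∀ n, I n → V) (functional : ∀ n, (I n → k) →ₗ[k] Module.Dual k V)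
  (δ : ∀ n, (I n → k) →ₗ[k] (I (n + 1) → k))

/-- The cochains `k^{I n}` with differential `δ` are the graded dual of the graded module `V` with
differential `d`: the family `chain n` spans the degree `n` part of `V`, cochains of degree `n` are
identified by `functional n` with functionals vanishing outside of degree `n`, and `δ` is
composition with `d`. -/
structure IsChainModel : Prop where
  chain_mem : ∀ n i, chain n i ∈ 𝒱 n
  le_span : ∀ n, 𝒱 n ≤ Submodule.span k (Set.range (chain n))
  functional_chain : ∀ n f i, functional n f (chain n i) = f i
  functional_of_ne : ∀ {m n}, m ≠ n → ∀ f, ∀ v ∈ 𝒱 m, functional n f v = 0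
  functional_diff : ∀ n f, functional (n + 1) (δ n f) = functional n f ∘ₗ d

/-- The functional on the chains given by an element of the total complex of cochains. -/
noncomputable def totalFunctional : Total k I →ₗ[k] Module.Dual k V :=
  DirectSum.toModule k ℕ _ functional

/-- The functional `μ (f ⊗ g)` with the Koszul sign `(-1)^{pq}`. -/
noncomputable def pairing (p q : ℕ) (f : I p → k) (g : I q → k) : V ⊗[k] V →ₗ[k] k :=
  (-1 : k) ^ (p * q) •
    (LinearMap.mul' k k ∘ₗ TensorProduct.map (functional p f) (functional q g))

theorem totalFunctional_homog (n : ℕ) (f : I n → k) :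
    totalFunctional functional (homog (k := k) I n f) = functional n f :=
  DirectSum.toModule_lof ..

theorem pairing_tmul (p q : ℕ) (f : I p → k) (g : I q → k) (a b : V) :
    pairing functional p q f g (a ⊗ₜ b) =
      (-1 : k) ^ (p * q) * (functional p f a * functional q g b) := by
  simp [pairing]

theorem totalProd_homog (r : ℕ → ℕ → ℕ)
    (c : ∀ p q, (I p → k) →ₗ[k] (I q → k) →ₗ[k] (I (r p q) → k)) (p q : ℕ) (f : I p → k)
    (g : I q → k) :
    totalProd I r c (homog (k := k) I p f ⊗ₜ homog (k := k) I q g) =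
      homog (k := k) I (r p q) (c p q f g) := by
  simp [totalProd, homog]

theorem totalFlip_homog (p q : ℕ) (f : I p → k) (g : I q → k) :
    totalFlip I (homog (k := k) I p f ⊗ₜ homog (k := k) I q g) =
      (-1 : k) ^ (p * q) • (homog (k := k) I q g ⊗ₜ homog (k := k) I p f) := by
  refine (TensorProduct.gradedComm_of_tmul_of k (fun n => I n → k) (fun n => I n → k)
    p q f g).trans ?_
  rw [Units.smul_def, ← Int.cast_smul_eq_zsmul k, mul_comm q p]
  congr 1
  simp

theorem totalDiff_homog (n : ℕ) (f : I n → k) :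
    totalDiff I δ (homog (k := k) I n f) = homog (k := k) I (n + 1) (δ n f) := by
  simp [totalDiff, homog]

theorem totalTensorDiff_homog (p q : ℕ) (f : I p → k) (g : I q → k) :
    totalTensorDiff I δ (homog (k := k) I p f ⊗ₜ homog (k := k) I q g) =
      (-1 : k) ^ q • (homog (k := k) I (p + 1) (δ p f) ⊗ₜ homog (k := k) I q g) +
        homog (k := k) I p f ⊗ₜ homog (k := k) I (q + 1) (δ q g) := by
  have h : (DirectSum.lmap fun n : ℕ => ((-1 : k) ^ n) • (LinearMap.id : (I n → k) →ₗ[k] _))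
      (homog (k := k) I q g) = (-1 : k) ^ q • homog (k := k) I q g := by
    rw [homog, DirectSum.lmap_lof]
    simp
  simp only [totalTensorDiff, LinearMap.add_apply, TensorProduct.map_tmul, h, totalDiff_homog,
    TensorProduct.tmul_smul, LinearMap.id_apply]

/-- Linear maps on the tensor square of the total complex are determined by their values on
tensors of homogeneous cochains. -/
theorem total_tensor_ext {W : Type*} [AddCommGroup W] [Module k W]
    {F G : Total k I ⊗[k] Total k I →ₗ[k] W}
    (h : ∀ p q (f : I p → k) (g : I q → k),
      F (homog (k := k) I p f ⊗ₜ homog (k := k) I q g) =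
        G (homog (k := k) I p f ⊗ₜ homog (k := k) I q g)) : F = G := by
  refine TensorProduct.ext (DirectSum.linearMap_ext _ fun p => LinearMap.ext fun f =>
    DirectSum.linearMap_ext _ fun q => LinearMap.ext fun g => ?_)
  exact h p q f g

variable {𝒱 d chain functional δ}

/-- Linear maps on `V ⊗ V` agree if they agree on tensors of homogeneous elements. -/
theorem tensor_ext_of_mem (𝒱 : ℕ → Submodule k V) [DirectSum.Decomposition 𝒱]
    {W : Type*} [AddCommGroup W] [Module k W] {F G : V ⊗[k] V →ₗ[k] W}
    (h : ∀ i j, ∀ a ∈ 𝒱 i, ∀ b ∈ 𝒱 j, F (a ⊗ₜ b) = G (a ⊗ₜ b)) : F = G := by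
  refine TensorProduct.ext' fun a b => ?_
  induction a using DirectSum.Decomposition.inductionOn 𝒱 with
  | zero => simp
  | add a a' iha iha' => simp only [TensorProduct.add_tmul, map_add, iha, iha']
  | @homogeneous i a =>
    induction b using DirectSum.Decomposition.inductionOn 𝒱 with
    | zero => simp
    | add b b' ihb ihb' => simp only [TensorProduct.tmul_add, map_add, ihb, ihb']
    | @homogeneous j b => exact h i j a a.2 b b.2

namespace IsChainModel

variable (H : IsChainModel 𝒱 d chain functional δ)
include H

theorem dual_ext {φ ψ : Module.Dual k V} (h : ∀ n i, φ (chain n i) = ψ (chain n i)) : φ = ψ := by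
  refine LinearMap.ext fun v => ?_
  induction v using DirectSum.Decomposition.inductionOn 𝒱 with
  | zero => simp
  | add a b iha ihb => simp [iha, ihb]
  | @homogeneous n v =>
    have hv := H.le_span n v.2
    generalize (v : V) = v at hv
    induction hv using Submodule.span_induction with
    | mem v hv =>
      obtain ⟨i, rfl⟩ := hv
      exact h n i
    | zero => simp
    | add a b _ _ iha ihb => simp [iha, ihb]
    | smul r a _ ih => simp [ih]

omit [DirectSum.Decomposition 𝒱] in
theorem totalFunctional_chain (t : Total k I) (n : ℕ) (i : I n) :
    totalFunctional functional t (chain n i) = t n i := by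
  induction t using DirectSum.induction_on with
  | zero => simp
  | add a b iha ihb => simp [iha, ihb]
  | of m f =>
    change totalFunctional functional (homog (k := k) I m f) (chain n i) =
      (homog (k := k) I m f) n i
    rw [totalFunctional_homog]
    rcases eq_or_ne n m with rfl | hne
    · rw [H.functional_chain]
      simp [homog]
    · rw [H.functional_of_ne hne f _ (H.chain_mem n i)]
      simp [homog, DirectSum.lof_eq_of, DirectSum.of_eq_of_ne _ _ _ hne]

omit [DirectSum.Decomposition 𝒱] in
theorem totalFunctional_injective : Function.Injective (totalFunctional (k := k) functional) := by
  intro s t h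
  refine DFinsupp.ext fun n => funext fun i => ?_
  have h' := LinearMap.congr_fun h (chain n i)
  rwa [H.totalFunctional_chain, H.totalFunctional_chain] at h'

omit [DirectSum.Decomposition 𝒱] in
theorem totalFunctional_totalDiff (t : Total k I) :
    totalFunctional functional (totalDiff I δ t) = totalFunctional functional t ∘ₗ d := by
  induction t using DirectSum.induction_on with
  | zero => simp
  | add a b iha ihb => simp [iha, ihb, LinearMap.add_comp]
  | of m f =>
    change totalFunctional functional (totalDiff I δ (homog (k := k) I m f)) =
      totalFunctional functional (homog (k := k) I m f) ∘ₗ d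
    rw [totalDiff_homog, totalFunctional_homog, totalFunctional_homog, H.functional_diff]

omit [DirectSum.Decomposition 𝒱] in
theorem pairing_of_ne {p q n : ℕ} (hn : n ≠ p + q) (f : I p → k) (g : I q → k) {t : V ⊗[k] V}
    (ht : t ∈ tensorGrade 𝒱 n) : pairing functional p q f g t = 0 := by
  induction ht using Submodule.span_induction with
  | mem t h =>
    obtain ⟨i, j, rfl, a, ha, b, hb, rfl⟩ := h
    rw [pairing_tmul]
    rcases eq_or_ne i p with rfl | hi
    · rw [H.functional_of_ne (by omega) g b hb]
      simp
    · rw [H.functional_of_ne hi f a ha]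
      simp
  | zero => simp
  | add a b _ _ iha ihb => simp [iha, ihb]
  | smul r a _ ih => simp [ih]

/-- If `Θ` has degree `s`, then the convolution product defined by `Θ` corresponds to the
functional `μ (f ⊗ g) Θ`.  The degree `r p q` of the product need only be right where `Θ` can take
values in degree `p + q`. -/
theorem totalFunctional_convolution {Θ : V →ₗ[k] V ⊗[k] V} {s : ℕ}
    (hΘ : ∀ n, ∀ v ∈ 𝒱 n, Θ v ∈ tensorGrade 𝒱 (n + s)) {r : ℕ → ℕ → ℕ}
    (hr : ∀ p q n, n + s = p + q → n = r p q) (p q : ℕ) (f : I p → k) (g : I q → k) :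
    totalFunctional functional
      (totalProd I r (fun p q => convolution chain functional Θ p q (r p q))
        (homog (k := k) I p f ⊗ₜ homog (k := k) I q g)) = pairing functional p q f g ∘ₗ Θ := by
  rw [totalProd_homog, totalFunctional_homog]
  refine H.dual_ext fun n i => ?_
  rcases eq_or_ne n (r p q) with rfl | hn
  · rw [H.functional_chain]
    rfl
  · rw [H.functional_of_ne hn _ _ (H.chain_mem n i), LinearMap.comp_apply,
      H.pairing_of_ne (fun h => hn (hr p q n h)) f g (hΘ n _ (H.chain_mem n i))]

/-- The Koszul sign of the pairing turns the signed flip of `V ⊗ V` into that of cochains. -/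
theorem pairing_comp_signedFlip (p q : ℕ) (f : I p → k) (g : I q → k) :
    pairing functional p q f g ∘ₗ signedFlip 𝒱 =
      (-1 : k) ^ (p * q) • pairing functional q p g f := by
  refine tensor_ext_of_mem 𝒱 fun i j a ha b hb => ?_
  rw [LinearMap.comp_apply, signedFlip_tmul 𝒱 ha hb, map_smul, LinearMap.smul_apply, pairing_tmul,
    pairing_tmul]
  rcases eq_or_ne i q with rfl | hi
  · rcases eq_or_ne j p with rfl | hj
    · rw [mul_comm i j, mul_comm (functional i g a)]
    · rw [H.functional_of_ne hj f b hb]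
      simp
  · rw [H.functional_of_ne hi g a ha]
    simp

/-- Composition with the differential of `V ⊗ V` is the differential of the tensor square of the
complex of cochains. -/
theorem pairing_comp_tensorDiff (p q : ℕ) (f : I p → k) (g : I q → k) :
    pairing functional p q f g ∘ₗ tensorDiff 𝒱 d =
      (-1 : k) ^ q • pairing functional (p + 1) q (δ p f) g +
        pairing functional p (q + 1) f (δ q g) := by
  refine tensor_ext_of_mem 𝒱 fun i j a ha b hb => ?_
  have hq : (-1 : k) ^ q * (-1) ^ q = 1 := by rw [← pow_add, Even.neg_one_pow ⟨_, rfl⟩]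
  have h : functional p f (parity 𝒱 a) = (-1) ^ p * functional p f a := by
    rw [parity_of_mem 𝒱 ha, map_smul, smul_eq_mul]
    rcases eq_or_ne i p with rfl | hi
    · rfl
    · rw [H.functional_of_ne hi f a ha, mul_zero, mul_zero]
  simp only [tensorDiff, LinearMap.comp_apply, LinearMap.add_apply, TensorProduct.map_tmul,
    LinearMap.id_apply, map_add, LinearMap.smul_apply, pairing_tmul, H.functional_diff, h,
    add_mul, mul_add, one_mul, mul_one, pow_add, smul_eq_mul]
  linear_combination (-(-1 : k) ^ (p * q) * functional p f (d a) * functional q g b) * hq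

/-- A convolution product is a morphism of complexes if `Θ` is a morphism of complexes of
degree `0`. -/
theorem totalDiff_comp_totalProd {Θ : V →ₗ[k] V ⊗[k] V}
    (hΘ : ∀ n, ∀ v ∈ 𝒱 n, Θ v ∈ tensorGrade 𝒱 n) (hd : tensorDiff 𝒱 d ∘ₗ Θ = Θ ∘ₗ d) :
    totalDiff I δ ∘ₗ
        totalProd I (fun p q => p + q) (fun p q => convolution chain functional Θ p q (p + q)) =
      totalProd I (fun p q => p + q) (fun p q => convolution chain functional Θ p q (p + q)) ∘ₗ
        totalTensorDiff I δ := by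
  have key := H.totalFunctional_convolution (s := 0) hΘ (r := fun p q => p + q)
    (fun _ _ _ h => h)
  refine total_tensor_ext fun p q f g => H.totalFunctional_injective ?_
  rw [LinearMap.comp_apply, LinearMap.comp_apply, H.totalFunctional_totalDiff,
    totalTensorDiff_homog, map_add, map_smul, map_add, map_smul, key, key, key,
    LinearMap.comp_assoc,
    ← hd, ← LinearMap.comp_assoc, H.pairing_comp_tensorDiff, LinearMap.add_comp,
    LinearMap.smul_comp]

/-- A homotopy `h` between `Θ` and `τΘ` induces a homotopy between the convolution product and its
opposite. -/
theorem totalProd_homotopy {Θ h : V →ₗ[k] V ⊗[k] V}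
    (hΘ : ∀ n, ∀ v ∈ 𝒱 n, Θ v ∈ tensorGrade 𝒱 n)
    (hh : ∀ n, ∀ v ∈ 𝒱 n, h v ∈ tensorGrade 𝒱 (n + 1))
    (hd : tensorDiff 𝒱 d ∘ₗ h + h ∘ₗ d = Θ - signedFlip 𝒱 ∘ₗ Θ) :
    totalProd I (fun p q => p + q) (fun p q => convolution chain functional Θ p q (p + q)) -
        totalProd I (fun p q => p + q) (fun p q => convolution chain functional Θ p q (p + q)) ∘ₗ
          totalFlip I =
      totalDiff I δ ∘ₗ totalProd I (fun p q => p + q - 1)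
          (fun p q => convolution chain functional h p q (p + q - 1)) +
        totalProd I (fun p q => p + q - 1)
          (fun p q => convolution chain functional h p q (p + q - 1)) ∘ₗ totalTensorDiff I δ := by
  have key := H.totalFunctional_convolution (s := 0) hΘ (r := fun p q => p + q)
    (fun _ _ _ h => h)
  have key' := H.totalFunctional_convolution hh (r := fun p q => p + q - 1)
    -- for `p = q = 0` the truncated `p + q - 1` does no harm, as `n + 1 = 0` is impossible
    (fun p q n h => by omega)
  refine total_tensor_ext fun p q f g => H.totalFunctional_injective ?_
  rw [LinearMap.sub_apply, LinearMap.add_apply, LinearMap.comp_apply, LinearMap.comp_apply,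
    LinearMap.comp_apply, totalFlip_homog, totalTensorDiff_homog, map_sub, map_smul, map_smul, key,
    key, map_add, H.totalFunctional_totalDiff, key', map_add, map_smul, map_add, map_smul, key',
    key', ← LinearMap.smul_comp, ← H.pairing_comp_signedFlip, LinearMap.comp_assoc,
    ← LinearMap.comp_sub, ← hd, LinearMap.comp_add, ← LinearMap.comp_assoc,
    H.pairing_comp_tensorDiff, LinearMap.add_comp, LinearMap.smul_comp, LinearMap.comp_assoc,
    add_comm]

end IsChainModel

end ChainModel

/-! ### The product induced in cohomology -/

section InducedProduct

variable {k : Type u} [CommRing k] {I : ℕ → Type v} (δ : ∀ n, (I n → k) →ₗ[k] (I (n + 1) → k))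

variable (k I) in
/-- The sign `f ↦ (-1)^{|f|} f` on the total complex. -/
noncomputable def totalSign : Total k I →ₗ[k] Total k I :=
  DirectSum.lmap fun n : ℕ => ((-1 : k) ^ n) • LinearMap.id

theorem totalSign_homog (n : ℕ) (f : I n → k) :
    totalSign k I (homog (k := k) I n f) = (-1 : k) ^ n • homog (k := k) I n f := by
  rw [totalSign, homog, DirectSum.lmap_lof]
  simp

theorem totalSign_totalSign (t : Total k I) : totalSign k I (totalSign k I t) = t := by
  induction t using DirectSum.induction_on with
  | zero => simp
  | add a b iha ihb => simp [iha, ihb]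
  | of n f =>
    change totalSign k I (totalSign k I (homog (k := k) I n f)) = homog (k := k) I n f
    rw [totalSign_homog, map_smul, totalSign_homog, smul_smul, ← pow_add,
      Even.neg_one_pow ⟨_, rfl⟩, one_smul]

theorem totalDiff_totalSign (t : Total k I) :
    totalDiff I δ (totalSign k I t) = (-1 : k) • totalSign k I (totalDiff I δ t) := by
  induction t using DirectSum.induction_on with
  | zero => simp
  | add a b iha ihb => simp only [map_add, iha, ihb, smul_add]
  | of n f =>
    change totalDiff I δ (totalSign k I (homog (k := k) I n f)) =
      (-1 : k) • totalSign k I (totalDiff I δ (homog (k := k) I n f))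
    rw [totalSign_homog, map_smul, totalDiff_homog, totalSign_homog, smul_smul]
    congr 1
    ring

theorem totalTensorDiff_tmul (s t : Total k I) :
    totalTensorDiff I δ (s ⊗ₜ t) =
      totalDiff I δ s ⊗ₜ totalSign k I t + s ⊗ₜ totalDiff I δ t := rfl

theorem classOf_surjective {V : Type v} [AddCommGroup V] [Module k V] (d : V →ₗ[k] V) :
    Function.Surjective (classOf d) :=
  Submodule.mkQ_surjective _

theorem classOf_eq_zero {V : Type v} [AddCommGroup V] [Module k V] {d : V →ₗ[k] V}
    {f : LinearMap.ker d} (h : (f : V) ∈ LinearMap.range d) : classOf d f = 0 :=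
  (Submodule.Quotient.mk_eq_zero _).2 h

variable {δ} {c : Total k I ⊗[k] Total k I →ₗ[k] Total k I}

theorem map_tmul_mem_ker (hc : totalDiff I δ ∘ₗ c = c ∘ₗ totalTensorDiff I δ)
    (f g : LinearMap.ker (totalDiff I δ)) :
    c ((f : Total k I) ⊗ₜ (g : Total k I)) ∈ LinearMap.ker (totalDiff I δ) := by
  have h := LinearMap.congr_fun hc ((f : Total k I) ⊗ₜ (g : Total k I))
  rw [LinearMap.comp_apply, LinearMap.comp_apply, totalTensorDiff_tmul, LinearMap.mem_ker.1 f.2,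
    LinearMap.mem_ker.1 g.2] at h
  simpa using h

/-- The class of the product of two cocycles, as a bilinear map. -/
noncomputable def cocycleProduct (hc : totalDiff I δ ∘ₗ c = c ∘ₗ totalTensorDiff I δ) :
    LinearMap.ker (totalDiff I δ) →ₗ[k] LinearMap.ker (totalDiff I δ) →ₗ[k]
      Cohomology (totalDiff I δ) :=
  LinearMap.mk₂ k (fun f g => classOf (totalDiff I δ) ⟨_, map_tmul_mem_ker hc f g⟩)
    (fun f f' g => by
      rw [← map_add]
      congr 1
      exact Subtype.ext (by simp [TensorProduct.add_tmul]))
    (fun r f g => by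
      rw [← map_smul]
      congr 1
      exact Subtype.ext (by simp [← TensorProduct.smul_tmul']))
    (fun f g g' => by
      rw [← map_add]
      congr 1
      exact Subtype.ext (by simp [TensorProduct.tmul_add]))
    (fun r f g => by
      rw [← map_smul]
      congr 1
      exact Subtype.ext (by simp))

theorem cocycleProduct_of_left (hc : totalDiff I δ ∘ₗ c = c ∘ₗ totalTensorDiff I δ)
    (f g : LinearMap.ker (totalDiff I δ)) (hf : (f : Total k I) ∈ LinearMap.range (totalDiff I δ)) :
    cocycleProduct hc f g = 0 := by
  obtain ⟨f', hf'⟩ := hf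
  -- the sign on `g` cancels the sign of `δ ⊗ Id` in `totalTensorDiff`
  refine classOf_eq_zero ⟨c (f' ⊗ₜ totalSign k I (g : Total k I)), ?_⟩
  have h := LinearMap.congr_fun hc (f' ⊗ₜ totalSign k I (g : Total k I))
  rw [LinearMap.comp_apply, LinearMap.comp_apply, totalTensorDiff_tmul, totalSign_totalSign,
    totalDiff_totalSign, LinearMap.mem_ker.1 g.2, hf'] at h
  simpa using h

theorem cocycleProduct_of_right (hc : totalDiff I δ ∘ₗ c = c ∘ₗ totalTensorDiff I δ)
    (f g : LinearMap.ker (totalDiff I δ)) (hg : (g : Total k I) ∈ LinearMap.range (totalDiff I δ)) :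
    cocycleProduct hc f g = 0 := by
  obtain ⟨g', hg'⟩ := hg
  refine classOf_eq_zero ⟨c ((f : Total k I) ⊗ₜ g'), ?_⟩
  have h := LinearMap.congr_fun hc ((f : Total k I) ⊗ₜ g')
  rw [LinearMap.comp_apply, LinearMap.comp_apply, totalTensorDiff_tmul, LinearMap.mem_ker.1 f.2,
    hg'] at h
  simpa using h

/-- The product in cohomology induced by a product of cochains that is a morphism of complexes. -/
noncomputable def inducedProduct (hc : totalDiff I δ ∘ₗ c = c ∘ₗ totalTensorDiff I δ) :
    Cohomology (totalDiff I δ) →ₗ[k] Cohomology (totalDiff I δ) →ₗ[k]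
      Cohomology (totalDiff I δ) :=
  Submodule.liftQ _
    (LinearMap.flip (Submodule.liftQ _ (cocycleProduct hc).flip fun g hg =>
      LinearMap.ext fun f => cocycleProduct_of_right hc f g hg))
    fun f hf => LinearMap.ext fun t => by
      obtain ⟨g, rfl⟩ := classOf_surjective _ t
      exact cocycleProduct_of_left hc f g hf

theorem isInducedProduct_inducedProduct
    (hc : totalDiff I δ ∘ₗ c = c ∘ₗ totalTensorDiff I δ) :
    IsInducedProduct (totalDiff I δ) c (inducedProduct hc) :=
  fun f g => ⟨map_tmul_mem_ker hc f g, rfl⟩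

theorem IsInducedProduct.eq {m m' : Cohomology (totalDiff I δ) →ₗ[k]
    Cohomology (totalDiff I δ) →ₗ[k] Cohomology (totalDiff I δ)}
    (hm : IsInducedProduct (totalDiff I δ) c m) (hm' : IsInducedProduct (totalDiff I δ) c m') :
    m = m' := by
  refine LinearMap.ext fun s => LinearMap.ext fun t => ?_
  obtain ⟨f, rfl⟩ := classOf_surjective _ s
  obtain ⟨g, rfl⟩ := classOf_surjective _ t
  obtain ⟨_, h⟩ := hm f g
  obtain ⟨_, h'⟩ := hm' f g
  exact h.trans h'.symm

/-- A product of cochains that is homotopic to its opposite induces a graded commutative product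
in cohomology. -/
theorem IsInducedProduct.isGradedCommutative {h : Total k I ⊗[k] Total k I →ₗ[k] Total k I}
    (hh : c - c ∘ₗ totalFlip I = totalDiff I δ ∘ₗ h + h ∘ₗ totalTensorDiff I δ)
    {m : Cohomology (totalDiff I δ) →ₗ[k]
      Cohomology (totalDiff I δ) →ₗ[k] Cohomology (totalDiff I δ)}
    (hm : IsInducedProduct (totalDiff I δ) c m) : IsGradedCommutative I δ m := by
  intro p q f g hf hg
  obtain ⟨h₁, e₁⟩ := hm f g
  obtain ⟨h₂, e₂⟩ := hm g f
  rw [e₁, e₂, ← map_smul, ← sub_eq_zero, ← map_sub]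
  refine classOf_eq_zero ⟨h ((f : Total k I) ⊗ₜ (g : Total k I)), ?_⟩
  have h₃ := LinearMap.congr_fun hh ((f : Total k I) ⊗ₜ (g : Total k I))
  have h₄ : totalFlip I ((f : Total k I) ⊗ₜ (g : Total k I)) =
      (-1 : k) ^ (p * q) • ((g : Total k I) ⊗ₜ (f : Total k I)) := by
    obtain ⟨f', hf'⟩ := hf
    obtain ⟨g', hg'⟩ := hg
    rw [← hf', ← hg', totalFlip_homog]
  rw [LinearMap.sub_apply, LinearMap.add_apply, LinearMap.comp_apply, LinearMap.comp_apply,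
    LinearMap.comp_apply, totalTensorDiff_tmul, LinearMap.mem_ker.1 f.2, LinearMap.mem_ker.1 g.2,
    h₄, map_smul, TensorProduct.zero_tmul, TensorProduct.tmul_zero, add_zero, map_zero,
    add_zero] at h₃
  exact h₃.symm

theorem existsUnique_gradedCommutative_product
    {h : Total k I ⊗[k] Total k I →ₗ[k] Total k I}
    (hc : totalDiff I δ ∘ₗ c = c ∘ₗ totalTensorDiff I δ)
    (hh : c - c ∘ₗ totalFlip I = totalDiff I δ ∘ₗ h + h ∘ₗ totalTensorDiff I δ) :
    ∃! m, IsInducedProduct (totalDiff I δ) c m ∧ IsGradedCommutative I δ m :=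
  ⟨inducedProduct hc, ⟨isInducedProduct_inducedProduct hc,
    (isInducedProduct_inducedProduct hc).isGradedCommutative hh⟩,
    fun _ hm => hm.1.eq (isInducedProduct_inducedProduct hc)⟩

end InducedProduct

/-! ### The homotopy `h` on `B̄(X)` -/

section Bar

variable (k : Type u) [CommRing k] (X : Type v) [Shelf X]

variable {X} in
theorem untwist_diffBB (t : BB k X) :
    untwist k X (diffBB k X t) = tensorDiff (gradeB k X) (diffB k X) (untwist k X t) := by
  simp [diffBB]

theorem tensorDiff_comp_coprodLin :
    tensorDiff (gradeB k X) (diffB k X) ∘ₗ coprodLin k X = coprodLin k X ∘ₗ diffB k X :=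
  LinearMap.ext fun b =>
    (untwist_diffBB k _).symm.trans (congrArg (untwist k X) (diffBB_coprod k b))

theorem homotopyLin_identity :
    tensorDiff (gradeB k X) (diffB k X) ∘ₗ homotopyLin k X + homotopyLin k X ∘ₗ diffB k X =
      coprodLin k X - signedFlip (gradeB k X) ∘ₗ coprodLin k X := by
  refine LinearMap.ext fun b => ?_
  have h := congrArg (untwist k X) (diffBB_homotopyB k b)
  rw [map_add, map_sub, untwist_diffBB, untwist_flipB] at h
  exact h

theorem coprodLin_mem (n : ℕ) (b : B k X) (hb : b ∈ gradeB k X n) :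
    coprodLin k X b ∈ tensorGrade (gradeB k X) n :=
  untwist_mem k (coprod_mem k hb)

theorem homotopyLin_mem (n : ℕ) (b : B k X) (hb : b ∈ gradeB k X n) :
    homotopyLin k X b ∈ tensorGrade (gradeB k X) (n + 1) :=
  untwist_mem k (homotopyB_mem k hb)

/-- The projection `B(X) ⊗ B(X) → B̄(X) ⊗ B̄(X)`. -/
noncomputable def toBarSq : B k X ⊗[k] B k X →ₗ[k] BBar k X ⊗[k] BBar k X :=
  TensorProduct.map (toBar k X) (toBar k X)

variable {X}

theorem toBarSq_tm_gx_mul (x : X) (t : BB k X) :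
    toBarSq k X (untwist k X (tm k (gx k x) (gx k x) * t)) = toBarSq k X (untwist k X t) := by
  induction t using BB_induction with
  | zero => simp
  | add s t ihs iht => simp only [mul_add, map_add, ihs, iht]
  | tmul i j a b ha hb =>
    rw [tm_mul_tm k (gx_mem k x) ha]
    simp [toBarSq, untwist_tm, toBar_gx_mul]

variable (X)

/-- The map induced by `h` on `B̄(X)`.  It exists because `h(x b) = (x ⊗ x) h(b)`. -/
noncomputable def homotopyBar : BBar k X →ₗ[k] BBar k X ⊗[k] BBar k X :=
  liftBar k (toBarSq k X ∘ₗ homotopyLin k X) fun x b => by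
    have h : homotopyB k X (gx k x * b) = tm k (gx k x) (gx k x) * homotopyB k X b := by
      rw [homotopyB_mul k (gx_mem k x), homotopyB_gx, flipB_coprod_gx]
      simp
    simp only [LinearMap.comp_apply, homotopyLin, LinearEquiv.coe_coe, h, toBarSq_tm_gx_mul]

theorem homotopyBar_comp_toBar : homotopyBar k X ∘ₗ toBar k X = toBarSq k X ∘ₗ homotopyLin k X :=
  rfl

theorem coprodBar_comp_toBar : coprodBar k X ∘ₗ toBar k X = toBarSq k X ∘ₗ coprodLin k X := rfl

theorem diffBar_comp_toBar : diffBar k X ∘ₗ toBar k X = toBar k X ∘ₗ diffB k X := rfl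

variable {X} in
theorem toBar_mem {n : ℕ} {b : B k X} (hb : b ∈ gradeB k X n) : toBar k X b ∈ gradeBar k X n :=
  Submodule.mem_map_of_mem hb

theorem signedFlip_comp_toBarSq :
    signedFlip (gradeBar k X) ∘ₗ toBarSq k X = toBarSq k X ∘ₗ signedFlip (gradeB k X) := by
  refine tensor_ext_of_mem (gradeB k X) fun i j a ha b hb => ?_
  simp only [LinearMap.comp_apply]
  rw [signedFlip_tmul _ ha hb, map_smul]
  exact signedFlip_tmul _ (toBar_mem k ha) (toBar_mem k hb)

theorem tensorDiff_comp_toBarSq :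
    tensorDiff (gradeBar k X) (diffBar k X) ∘ₗ toBarSq k X =
      toBarSq k X ∘ₗ tensorDiff (gradeB k X) (diffB k X) := by
  refine tensor_ext_of_mem (gradeB k X) fun i j a ha b hb => ?_
  simp only [LinearMap.comp_apply, toBarSq, tensorDiff, LinearMap.add_apply,
    TensorProduct.map_tmul, parity_of_mem _ ha, parity_of_mem _ (toBar_mem k ha), map_add, map_smul,
    LinearMap.id_apply, diffBar_toBar]

variable {X} in
theorem linearMap_ext_bar {W : Type*} [AddCommGroup W] [Module k W] {f g : BBar k X →ₗ[k] W}
    (h : f ∘ₗ toBar k X = g ∘ₗ toBar k X) : f = g :=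
  (LinearMap.cancel_right (toBar_surjective k X)).1 h

theorem tensorDiff_comp_coprodBar :
    tensorDiff (gradeBar k X) (diffBar k X) ∘ₗ coprodBar k X = coprodBar k X ∘ₗ diffBar k X := by
  refine linearMap_ext_bar k ?_
  rw [LinearMap.comp_assoc, LinearMap.comp_assoc, coprodBar_comp_toBar, diffBar_comp_toBar,
    ← LinearMap.comp_assoc, ← LinearMap.comp_assoc, tensorDiff_comp_toBarSq, coprodBar_comp_toBar,
    LinearMap.comp_assoc, LinearMap.comp_assoc, tensorDiff_comp_coprodLin]

theorem homotopyBar_identity :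
    tensorDiff (gradeBar k X) (diffBar k X) ∘ₗ homotopyBar k X + homotopyBar k X ∘ₗ diffBar k X =
      coprodBar k X - signedFlip (gradeBar k X) ∘ₗ coprodBar k X := by
  refine linearMap_ext_bar k ?_
  have h := congrArg (toBarSq k X ∘ₗ ·) (homotopyLin_identity k X)
  simp only [LinearMap.comp_add, LinearMap.comp_sub, ← LinearMap.comp_assoc,
    ← tensorDiff_comp_toBarSq, ← signedFlip_comp_toBarSq] at h
  exact h

variable {X} in
theorem toBarSq_mem {n : ℕ} {t : B k X ⊗[k] B k X} (ht : t ∈ tensorGrade (gradeB k X) n) :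
    toBarSq k X t ∈ tensorGrade (gradeBar k X) n := by
  induction ht using Submodule.span_induction with
  | mem t h =>
    obtain ⟨i, j, hn, a, ha, b, hb, rfl⟩ := h
    exact Submodule.subset_span
      ⟨i, j, hn, _, toBar_mem k ha, _, toBar_mem k hb, (TensorProduct.map_tmul ..).symm⟩
  | zero => simp
  | add a b _ _ iha ihb => rw [map_add]; exact Submodule.add_mem _ iha ihb
  | smul r a _ ih => rw [map_smul]; exact Submodule.smul_mem _ _ ih

theorem coprodBar_mem (n : ℕ) (t : BBar k X) (ht : t ∈ gradeBar k X n) :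
    coprodBar k X t ∈ tensorGrade (gradeBar k X) n := by
  obtain ⟨b, hb, rfl⟩ := ht
  exact toBarSq_mem k (coprodLin_mem k X n b hb)

theorem homotopyBar_mem (n : ℕ) (t : BBar k X) (ht : t ∈ gradeBar k X n) :
    homotopyBar k X t ∈ tensorGrade (gradeBar k X) (n + 1) := by
  obtain ⟨b, hb, rfl⟩ := ht
  exact toBarSq_mem k (homotopyLin_mem k X n b hb)

end Bar

/-! ### Rack cochains as functionals -/

section RackCochains

variable (k : Type u) [CommRing k] (X : Type v) [Shelf X]

variable {X}

theorem functionalB_chainB (n : ℕ) (f : IndM X n → k) (p : IndM X n) :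
    functionalB k X n f (chainB k X n p) = f p := by
  rw [chainB, ← basisB_apply, functionalB, LinearMap.comp_apply, LinearEquiv.coe_coe,
    Module.Basis.constr_basis]
  simp

theorem functionalB_of_ne {m n : ℕ} (h : m ≠ n) (f : IndM X n → k) (b : B k X)
    (hb : b ∈ gradeB k X m) : functionalB k X n f b = 0 := by
  rw [gradeB_eq_span_chainB] at hb
  induction hb using Submodule.span_induction with
  | mem b hb =>
    obtain ⟨p, rfl⟩ := hb
    rw [chainB, ← basisB_apply, functionalB, LinearMap.comp_apply, LinearEquiv.coe_coe,
      Module.Basis.constr_basis]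
    simp [h.symm]
  | zero => simp
  | add a b _ _ iha ihb => simp [iha, ihb]
  | smul r a _ ih => simp [ih]

theorem toBar_chainB (n : ℕ) (p : IndM X n) :
    toBar k X (chainB k X n p) = chainBar k X n p.2 := toBar_canonical k _

/-- A cochain of degree `n` with trivial coefficients, pulled back to `B(X)`, is the cochain with
coefficients in `k^{M(X)}` that is constant in `M(X)`. -/
theorem functionalBar_toBar (n : ℕ) (f : Ind X n → k) (b : B k X) :
    functionalBar k X n f (toBar k X b) = functionalB k X n (fun p => f p.2) b := by
  suffices h : functionalBar k X n f ∘ₗ toBar k X = functionalB k X n fun p => f p.2 from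
    LinearMap.congr_fun h b
  refine (basisB k X).ext fun p => ?_
  rw [functionalB, LinearMap.comp_apply, LinearMap.comp_apply, LinearEquiv.coe_coe,
    Module.Basis.constr_basis, basisB_apply, toBar_canonical, ← basisBar_apply, functionalBar,
    LinearMap.comp_apply, LinearEquiv.coe_coe, Module.Basis.constr_basis]
  by_cases h : n = p.2.length <;> simp [h]

variable (X)

theorem isChainModel_B :
    IsChainModel (gradeB k X) (diffB k X) (chainB k X) (functionalB k X) (rackDiffM k X) where
  chain_mem := chainB_mem k
  le_span n := (gradeB_eq_span_chainB k n).le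
  functional_chain := functionalB_chainB k
  functional_of_ne := functionalB_of_ne k
  functional_diff n f := by
    refine (basisB k X).ext fun p => ?_
    rw [basisB_apply, canonical_eq_chainB, LinearMap.comp_apply]
    generalize ((p.1, p.2.get) : IndM X p.2.length) = q
    generalize p.2.length = m at q
    cases m with
    | zero =>
      rw [diffB_chainB_zero, map_zero, functionalB_of_ne k (Nat.succ_ne_zero n).symm _ _
        (chainB_mem k _ q)]
    | succ m =>
      rcases eq_or_ne m n with rfl | hm
      · rw [functionalB_chainB, diffB_chainB]
        simp only [map_sum, map_smul, map_sub, functionalB_chainB, smul_eq_mul]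
        rfl
      · rw [functionalB_of_ne k (by omega) _ _ (chainB_mem k _ q),
          functionalB_of_ne k hm _ _ (diffB_mem_of_succ k (chainB_mem k _ q))]

theorem isChainModel_bar :
    IsChainModel (gradeBar k X) (diffBar k X) (chainBar k X) (functionalBar k X)
      (rackDiff k X) where
  chain_mem n x := by
    rw [← toBar_chainB k n (1, x)]
    exact toBar_mem k (chainB_mem k n _)
  le_span n := by
    rw [gradeBar, gradeB_eq_span_chainB, Submodule.map_span, Submodule.span_le]
    rintro _ ⟨_, ⟨p, rfl⟩, rfl⟩
    rw [toBar_chainB]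
    exact Submodule.subset_span ⟨_, rfl⟩
  functional_chain n f x := by
    rw [← toBar_chainB k n (1, x), functionalBar_toBar, functionalB_chainB]
  functional_of_ne h f t ht := by
    obtain ⟨b, hb, rfl⟩ := ht
    rw [functionalBar_toBar, functionalB_of_ne k h _ _ hb]
  functional_diff n f := by
    refine linearMap_ext_bar k (LinearMap.ext fun b => ?_)
    have h := LinearMap.congr_fun ((isChainModel_B k X).functional_diff n fun p => f p.2) b
    simp only [LinearMap.comp_apply, diffBar_toBar, functionalBar_toBar] at h ⊢
    exact h

end RackCochains

end RackHomotopy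

theorem mainTheorem2 (k : Type u) [CommRing k] (X : Type v) [Shelf X] :
    -- the explicit formula for `h` on the canonical monomials
    (∀ (a : StructureMonoid X) (w : List X),
      homotopyB k X (monB k X a * eWord k w) =
        ∑ i : Fin w.length, (-1 : k) ^ (i : ℕ) •
          (tm k (monB k X a) (monB k X a) *
            flipB k X (coprod k X (eWord k (w.take i))) *
            tm k (ge k (w.get i)) (ge k (w.get i)) *
            coprod k X (eWord k (w.drop (i + 1))))) ∧
    -- `h` has degree 1
    (∀ n : ℕ, ∀ b ∈ gradeB k X n,
      homotopyLin k X b ∈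
        tensorGrade (gradeB k X) (n + 1)) ∧
    -- `h(b₁ b₂) = h(b₁) Δ(b₂) + (-1)^{|b₁|} (τΔ)(b₁) h(b₂)`
    (∀ i j : ℕ, ∀ b₁ ∈ gradeB k X i, ∀ b₂ ∈ gradeB k X j,
      homotopyB k X (b₁ * b₂) =
        homotopyB k X b₁ * coprod k X b₂ +
          (-1 : k) ^ i • (flipB k X (coprod k X b₁) *
            homotopyB k X b₂)) ∧
    -- `(d ⊗ Id + Id ⊗ d) h + h d = Δ - τΔ` on `B(X)`
    tensorDiff (gradeB k X) (diffB k X) ∘ₗ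
          homotopyLin k X +
        homotopyLin k X ∘ₗ diffB k X =
      coprodLin k X -
        signedFlip (gradeB k X) ∘ₗ coprodLin k X ∧
    -- `h` induces a map on `B̄(X)`, which is a homotopy between `Δ` and `τΔ` on `B̄(X)` and
    -- induces a homotopy between the cup product and its opposite on `C^•(X)`
    (∃ hbar : BBar k X →ₗ[k] BBar k X ⊗[k] BBar k X,
      hbar ∘ₗ toBar k X =
        TensorProduct.map (toBar k X) (toBar k X) ∘ₗ
          homotopyLin k X ∧
      tensorDiff (gradeBar k X) (diffBar k X) ∘ₗ hbar +
          hbar ∘ₗ diffBar k X =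
        coprodBar k X -
          signedFlip (gradeBar k X) ∘ₗ coprodBar k X ∧
      cup k X - cup k X ∘ₗ totalFlip (Ind X) =
        totalDiff (Ind X) (rackDiff k X) ∘ₗ
            cupHomotopy k X hbar +
          cupHomotopy k X hbar ∘ₗ
            totalTensorDiff (Ind X) (rackDiff k X)) ∧
    -- `h` induces a homotopy between the cup product and its opposite on `C^•(X, M(X))`
    cupM k X - cupM k X ∘ₗ totalFlip (IndM X) =
      totalDiff (IndM X) (rackDiffM k X) ∘ₗ
          cupHomotopyM k X (homotopyLin k X) +
        cupHomotopyM k X (homotopyLin k X) ∘ₗ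
          totalTensorDiff (IndM X) (rackDiffM k X) ∧
    -- the cup products are morphisms of complexes
    totalDiff (Ind X) (rackDiff k X) ∘ₗ cup k X =
      cup k X ∘ₗ totalTensorDiff (Ind X) (rackDiff k X) ∧
    totalDiff (IndM X) (rackDiffM k X) ∘ₗ cupM k X =
      cupM k X ∘ₗ totalTensorDiff (IndM X) (rackDiffM k X) ∧
    -- the products induced in rack cohomology are graded commutative
    (∃! m, IsInducedProduct
        (totalDiff (Ind X) (rackDiff k X)) (cup k X) m ∧
      IsGradedCommutative (Ind X) (rackDiff k X) m) ∧
    (∃! m, IsInducedProduct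
        (totalDiff (IndM X) (rackDiffM k X)) (cupM k X) m ∧
      IsGradedCommutative (IndM X) (rackDiffM k X) m) := by
  have hcup := (isChainModel_bar k X).totalDiff_comp_totalProd (coprodBar_mem k X)
    (tensorDiff_comp_coprodBar k X)
  have hcupM := (isChainModel_B k X).totalDiff_comp_totalProd (coprodLin_mem k X)
    (tensorDiff_comp_coprodLin k X)
  have hH := (isChainModel_bar k X).totalProd_homotopy (coprodBar_mem k X) (homotopyBar_mem k X)
    (homotopyBar_identity k X)
  have hHM := (isChainModel_B k X).totalProd_homotopy (coprodLin_mem k X) (homotopyLin_mem k X)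
    (homotopyLin_identity k X)
  exact ⟨homotopyB_canonical k, homotopyLin_mem k X, fun i j b₁ h₁ b₂ _ => homotopyB_mul k h₁ b₂,
    homotopyLin_identity k X,
    ⟨homotopyBar k X, homotopyBar_comp_toBar k X, homotopyBar_identity k X, hH⟩, hHM, hcup, hcupM,
    existsUnique_gradedCommutative_product hcup hH,
    existsUnique_gradedCommutative_product hcupM hHM⟩
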